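/- Let $g$ be a non-constant meromorphic function on $\mathbb C$. Write $m(r,g)=\frac1{2\pi}\int_0^{2\pi}\log^+|g(re^{i\theta})|\,d\theta$, let $T(r,g)=m(r,g)+N(r,g)$ be its Nevanlinna characteristic, and for $a\in\mathbb C\cup\{\infty\}$ let $N(r,g=a)$ be the integrated counting function of the $a$-points of $g$, counted with multiplicity; thus $N(r,g)=N(r,g=\infty)$. Here the integrated counting function attached to a number $n(t)$ of points in $\{|z|\le t\}$ is $\int_0^r\frac{n(t)-n(0)}t\,dt+n(0)\log r$. Let $q,c\in\mathbb C$ with $0<|q|<1$, and let $$\mathcal D_{q,c}g(z)=\frac{g(qz+c)-g(z)}{(q-1)z+c}$$ be the Hahn difference operator. For $a\in\mathbb C\cup\{\infty\}$ let $\hat n_{q,c}(r,g=a)$ be the sum of $n-\min\{n,m'\}$ over the points $z$ with $|z|\le r$ at which $g$ takes the value $a$, where $n$ is the multiplicity with which $g$ takes the value $a$ at $z$, and $m'\ge 0$ is the multiplicity of $z$ as a zero of $\mathcal D_{q,c}g$ if $a\in\mathbb C$, and of $\mathcal D_{q,c}(1/g)$ if $a=\infty$ (with $m'=0$ if $z$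 is not a zero). Let $\hat N_{q,c}(r,g=a)$ be the corresponding integrated counting function. Put $$\delta(a,g)=1-\limsup_{r\to\infty}\frac{N(r,g=a)}{T(r,g)},\qquad \theta_{q,c}(a,g)=\liminf_{r\to\infty}\frac{N(r,g=a)-\hat N_{q,c}(r,g=a)}{T(r,g)},$$ $$\Theta_{q,c}(a,g)=1-\limsup_{r\to\infty}\frac{\hat N_{q,c}(r,g=a)}{T(r,g)}.$$ Suppose that $g$ has order zero, that is, $\limsup_{r\to\infty}\frac{\log^+T(r,g)}{\log r}=0$. Then the following two sums converge, and $$\sum_{a\in\mathbb C\cup\{\infty\}}\bigl(\delta(a,g)+\theta_{q,c}(a,g)\bigr)\le\sum_{a\in\mathbb C\cup\{\infty\}}\Theta_{q,c}(a,g)\le 2.$$ -/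

import Mathlib

open Filter Topology MeromorphicOn ValueDistribution

noncomputable section

namespace HahnNevanlinna

/-- The Hahn difference operator `g ↦ (g (q z + c) - g z) / ((q - 1) z + c)`. -/
def hahnDiff (q c : ℂ) (g : ℂ → ℂ) : ℂ → ℂ :=
  fun z ↦ (g (q * z + c) - g z) / ((q - 1) * z + c)

/-- The function is non-constant as a meromorphic function: it does not agree with a constant
outside of a closed discrete set. (Mathlib's predicate `Meromorphic` leaves the values of a function
on a closed discrete set unconstrained.) -/
def NonConstant (g : ℂ → ℂ) : Prop :=
  ¬ ∃ w : ℂ, g =ᶠ[codiscrete ℂ] fun _ ↦ w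

/-- The Nevanlinna characteristic `T(r, g) = m(r, g) + N(r, g)`. -/
def T (g : ℂ → ℂ) (r : ℝ) : ℝ := characteristic g ⊤ r

/-- The order of growth `limsup log⁺ T(r, g) / log r`, as an extended real number. -/
def growthOrder (g : ℂ → ℂ) : EReal :=
  limsup (fun r : ℝ ↦ ((Real.posLog (T g r) / Real.log r : ℝ) : EReal)) atTop

/-- The Hahn-type divisor of `a`-points of `g`, where `a ∈ ℂ ∪ {∞}`. Its value at `z` is
`n - min n m'`, where `n` is the multiplicity with which `g` takes the value `a` at `z` and
`m'` is the multiplicity of `z` as a zero of the Hahn difference of `g` (if `a` is finite) or of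
`1 / g` (if `a = ∞`). -/
def hahnDivisor (q c : ℂ) (g : ℂ → ℂ) : WithTop ℂ → Function.locallyFinsupp ℂ ℤ
  | ⊤ => (divisor g Set.univ)⁻ -
      (divisor g Set.univ)⁻ ⊓ (divisor (hahnDiff q c g⁻¹) Set.univ)⁺
  | (a : ℂ) => (divisor (g · - a) Set.univ)⁺ -
      (divisor (g · - a) Set.univ)⁺ ⊓ (divisor (hahnDiff q c g) Set.univ)⁺

/-- The Hahn-type integrated counting function of the `a`-points of `g`. -/
def hahnCounting (q c : ℂ) (g : ℂ → ℂ) (a : WithTop ℂ) : ℝ → ℝ :=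
  Function.locallyFinsuppWithin.logCounting (hahnDivisor q c g a)

/-- The Nevanlinna defect `δ(a, g)`. For non-constant meromorphic `g`, the quotients in this and in
the next two definitions are bounded for large `r`, so the real upper and lower limits are the
true ones. -/
def defect (g : ℂ → ℂ) (a : WithTop ℂ) : ℝ :=
  1 - limsup (fun r : ℝ ↦ logCounting g a r / T g r) atTop

/-- The Hahn-type multiplicity index `θ_{q,c}(a, g)`. -/
def hahnMultiplicityIndex (q c : ℂ) (g : ℂ → ℂ) (a : WithTop ℂ) : ℝ :=
  liminf (fun r : ℝ ↦ (logCounting g a r - hahnCounting q c g a r) / T g r) atTop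

/-- The Hahn-type ramification index `Θ_{q,c}(a, g)`. -/
def hahnRamificationIndex (q c : ℂ) (g : ℂ → ℂ) (a : WithTop ℂ) : ℝ :=
  1 - limsup (fun r : ℝ ↦ hahnCounting q c g a r / T g r) atTop

end HahnNevanlinna

end

/-! ### Circle averages of logarithmic kernels and the oscillation of harmonic functions -/

namespace HahnNevanlinna

open Real Metric

/-! Nevanlinna's second main theorem, with `D = hahnDiff q c` in place of the derivative and φ(z) =
qz + c. For finitely many values a, up to bounded terms, Σ m(r, 1/(g-a)) ≤ Σ m(r, Dg/(g-a)) + m(r,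
1/Dg), and the first main theorem turns m(r, 1/Dg) into m(r, Dg) + N(r, Dg) - N(r, 1/Dg), where m(r,
Dg) ≤ m(r, g) + m(r, Dg/g).

Three facts finish the estimate. The quotients cost little: m(r, f∘φ/f) ≤ η T(k²r, f) + O(1) for
every η > 0 once k is large (`exists_circleAverage_posLog_comp_div_le`). Outside a disk φ does not
increase the modulus, so N(r, g∘φ) ≤ N(r, g) + O(1) (`exists_logCounting_comp_affine_le`). Local
orders bound the poles of Dg together with the part removed at ∞
(`NonConstant.negPart_divisor_hahnDiff_add_le`), while the parts removed at finite values sum to at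
most the zeros of Dg (`sum_inf_divisor_le`).

Order zero gives T(k²r) ≤ 2T(r) for arbitrarily large r (`frequently_T_mul_le`). Such radii suffice:
each Θ bounds its counting function at all large r, so one good radius bounds a finite sum of the Θ
by 2 + ε. The comparison with δ + θ is superadditivity of limsup against liminf. -/

lemma circleAverage_mono_codiscreteWithin {f₁ f₂ : ℂ → ℝ} {r : ℝ} (hr : r ≠ 0)
    (h₁ : CircleIntegrable f₁ 0 r) (h₂ : CircleIntegrable f₂ 0 r)
    (h : ∀ᶠ z in codiscreteWithin (sphere (0 : ℂ) |r|), f₁ z ≤ f₂ z) :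
    circleAverage f₁ 0 r ≤ circleAverage f₂ 0 r := by
  -- Replacing f₁ by min(f₁, f₂) keeps its average and makes the inequality hold everywhere.
  have h' : f₁ =ᶠ[codiscreteWithin (sphere (0 : ℂ) |r|)] fun z ↦ min (f₁ z) (f₂ z) := by
    filter_upwards [h] with z hz using (min_eq_left hz).symm
  rw [circleAverage_congr_codiscreteWithin h' hr]
  exact circleAverage_mono (h₁.congr_codiscreteWithin h') h₂ fun z _ ↦ min_le_right _ _

lemma posLog_div_of_pos {r x : ℝ} (hr : 0 < r) (hx : 0 < x) :
    log⁺ (r / x) = log⁺ (x / r) - (log x - log r) := by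
  have := posLog_sub_posLog_inv (x := x / r)
  rw [inv_div, log_div hx.ne' hr.ne'] at this
  linarith

lemma eventually_norm_sub_pos (u : ℂ) (s : Set ℂ) :
    ∀ᶠ z in codiscreteWithin s, 0 < ‖z - u‖ := by
  have h : ({u} : Set ℂ)ᶜ ∈ codiscreteWithin s := compl_singleton_mem_codiscreteWithin u
  filter_upwards [h] with z hz
  exact norm_pos_iff.2 (sub_ne_zero.2 hz)

lemma circleIntegrable_posLog_div_norm_sub (b : ℝ) (u : ℂ) (r : ℝ) :
    CircleIntegrable (fun z ↦ log⁺ (b / ‖z - u‖)) 0 r := by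
  have h : MeromorphicOn (fun z : ℂ ↦ (b : ℂ) / (z - u)) (sphere 0 |r|) :=
    fun _ _ ↦ by fun_prop
  have := h.circleIntegrable_posLog_norm
  refine this.congr_codiscreteWithin ?_
  filter_upwards with z
  rw [norm_div, Complex.norm_real, Real.norm_eq_abs, ← posLog_abs (b / _), abs_div, abs_norm]

/-- Up to log 2, log⁺(r/|z-u|) is at most log⁺(|u|/r) + log r - log|z-u|. By Jensen, log|z-u| has
mean log r + log⁺(|u|/r), so the dependence on u cancels. -/
lemma circleAverage_posLog_div_norm_sub_le {r : ℝ} (hr : 0 < r) (u : ℂ) :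
    circleAverage (fun z ↦ log⁺ (r / ‖z - u‖)) 0 r ≤ log 2 := by
  have h : ∀ᶠ z in codiscreteWithin (sphere (0 : ℂ) |r|),
      log⁺ (r / ‖z - u‖) ≤ (log 2 + log⁺ (‖u‖ / r) + log r) - log ‖z - u‖ := by
    filter_upwards [eventually_norm_sub_pos u _, self_mem_codiscreteWithin _] with z hz hz'
    rw [posLog_div_of_pos hr hz]
    have h1 : ‖z‖ = r := by simpa [abs_of_pos hr] using hz'
    have : log⁺ (‖z - u‖ / r) ≤ log 2 + log⁺ (‖u‖ / r) := by
      calc log⁺ (‖z - u‖ / r) ≤ log⁺ (1 + ‖u‖ / r) := by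
            apply posLog_le_posLog (by positivity)
            rw [div_le_iff₀ hr]
            have := norm_sub_le z u
            field_simp
            linarith
        _ ≤ log 2 + log⁺ 1 + log⁺ (‖u‖ / r) := posLog_add
        _ = _ := by simp
    linarith
  have h2 := circleIntegrable_log_norm_sub_const (a := u) (c := 0) r
  refine (circleAverage_mono_codiscreteWithin hr.ne'
    (circleIntegrable_posLog_div_norm_sub _ _ _) ((circleIntegrable_const _ _ _).sub h2) h).trans ?_
  have := circleAverage_sub (circleIntegrable_const (log 2 + log⁺ (‖u‖ / r) + log r) 0 r) h2
  rw [circleAverage_const, circleAverage_log_norm_sub_const_eq_log_radius_add_posLog hr.ne'] at this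
  refine (le_of_eq this).trans ?_
  rw [zero_sub, norm_neg, inv_mul_eq_div]
  linarith

/-- The function x = log|z-u| - log R has mean zero when |u| ≤ R, and x ≤ log 2 gives |x| ≤ 2 log 2
- x. -/
lemma circleAverage_abs_log_norm_sub_sub_log_le {R : ℝ} (hR : 0 < R) {u : ℂ} (hu : ‖u‖ ≤ R) :
    circleAverage (fun z ↦ |log ‖z - u‖ - log R|) 0 R ≤ 2 * log 2 := by
  have h2 := circleIntegrable_log_norm_sub_const (a := u) (c := 0) R
  have h3 := h2.sub (circleIntegrable_const (log R) 0 R)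
  have h : ∀ᶠ z in codiscreteWithin (sphere (0 : ℂ) |R|),
      |log ‖z - u‖ - log R| ≤ (2 * log 2 + log R) - log ‖z - u‖ := by
    filter_upwards [eventually_norm_sub_pos u _, self_mem_codiscreteWithin _] with z hz hz'
    have h1 : ‖z‖ = R := by simpa [abs_of_pos hR] using hz'
    have : log ‖z - u‖ ≤ log 2 + log R := by
      rw [← log_mul two_ne_zero hR.ne']
      exact log_le_log hz (by linarith [norm_sub_le z u])
    rw [abs_le]
    constructor <;> linarith [log_nonneg (x := 2) (by norm_num)]
  refine (circleAverage_mono_codiscreteWithin hR.ne' h3.abs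
    ((circleIntegrable_const _ _ _).sub h2) h).trans ?_
  have := circleAverage_sub (circleIntegrable_const (2 * log 2 + log R) 0 R) h2
  rw [circleAverage_const, circleAverage_log_norm_sub_const_of_mem_closedBall
    (by simpa [abs_of_pos hR] using hu)] at this
  exact (le_of_eq this).trans (by linarith)

/-- Oscillation of a harmonic function well inside of a disk. -/
lemma abs_harmonic_sub_le {v : ℂ → ℝ} {R s : ℝ} (hR : 0 < R)
    (hv : InnerProductSpace.HarmonicOnNhd v (closedBall 0 R)) (hs : s ≤ 1 / 2) {z w : ℂ}
    (hz : ‖z‖ ≤ s * R) (hw : ‖w‖ ≤ s * R) :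
    |v z - v w| ≤ 8 * s * circleAverage |v| 0 R := by
  have hs0 : 0 ≤ s := by
    by_contra! h
    nlinarith [norm_nonneg z]
  have hvc : ContinuousOn v (sphere 0 R) := fun x hx ↦
    (hv x (sphere_subset_closedBall hx)).1.continuousAt.continuousWithinAt
  have hlt : s * R < R := by nlinarith
  -- The Poisson kernel lies between (R-|x|)/(R+|x|) and its inverse, hence within 4s of 1 as s ≤
  -- 1/2. The kernels at two points then differ by at most 8s.
  have key : ∀ x : ℂ, ‖x‖ ≤ s * R →
      CircleIntegrable (poissonKernel 0 x • v) 0 R ∧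
      ∀ ζ ∈ sphere (0 : ℂ) R, |poissonKernel 0 x ζ - 1| ≤ 4 * s := by
    intro x hx
    have hxb : x ∈ ball (0 : ℂ) R := by simpa using hx.trans_lt hlt
    constructor
    · apply ContinuousOn.circleIntegrable hR.le
      rw [poissonKernel_eq_re_herglotzRieszKernel]
      have h := continuousOn_herglotzRieszKernel_sphere (c := 0) (R := R) hxb
      rw [abs_of_pos hR] at h
      exact (Complex.continuous_re.comp_continuousOn h).mul hvc
    · intro ζ hζ
      have h1 := re_herglotzRieszKernel_le hζ hxb
      have h2 := le_re_herglotzRieszKernel hζ hxb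
      have h3 : poissonKernel 0 x ζ = ((ζ - 0 + (x - 0)) / ((ζ - 0) - (x - 0))).re := by
        rw [poissonKernel_eq_re_herglotzRieszKernel, Function.comp_apply, herglotzRieszKernel_def]
      rw [← h3, sub_zero] at h1 h2
      have hn := norm_nonneg x
      have h4 : (R + ‖x‖) / (R - ‖x‖) ≤ 1 + 4 * s := by
        rw [div_le_iff₀ (by linarith)]
        nlinarith
      have h5 : 1 - 4 * s ≤ (R - ‖x‖) / (R + ‖x‖) := by
        rw [le_div_iff₀ (by linarith)]
        nlinarith
      rw [abs_le]
      constructor <;> linarith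
  have hzb : z ∈ ball (0 : ℂ) R := by simpa using hz.trans_lt hlt
  have hwb : w ∈ ball (0 : ℂ) R := by simpa using hw.trans_lt hlt
  rw [← hv.circleAverage_poissonKernel_smul hzb, ← hv.circleAverage_poissonKernel_smul hwb,
    ← circleAverage_sub (key z hz).1 (key w hw).1]
  refine abs_circleAverage_le_circleAverage_abs.trans ?_
  rw [← smul_eq_mul, ← circleAverage_smul]
  refine circleAverage_mono ((key z hz).1.sub (key w hw).1).abs
    ((hvc.circleIntegrable hR.le).abs.const_smul) fun ζ hζ ↦ ?_
  rw [abs_of_pos hR] at hζ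
  have h1 := (key z hz).2 ζ hζ
  have h2 := (key w hw).2 ζ hζ
  simp only [Pi.abs_apply, Pi.sub_apply, smul_eq_mul, Pi.smul_apply, Pi.mul_apply]
  rw [← sub_mul, abs_mul]
  gcongr
  rw [abs_le] at *
  constructor <;> linarith

end HahnNevanlinna

/-! ### The mean of log⁺|f(qz + c)/f(z)| on a circle -/

namespace HahnNevanlinna

open Real Metric

/-- On a disk, `log ‖f‖` is the sum of a harmonic function and of normalized logarithmic
potentials of the zeros and poles. -/
lemma exists_harmonic_add_sum_eq_log_norm {f : ℂ → ℂ} (hf : Meromorphic f)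
    (hf' : ∀ z, meromorphicOrderAt f z ≠ ⊤) (R : ℝ) :
    ∃ (v : ℂ → ℝ) (S : Finset ℂ), InnerProductSpace.HarmonicOnNhd v (closedBall 0 R) ∧
      (∀ u ∈ S, ‖u‖ ≤ R) ∧
      ∀ᶠ z in codiscreteWithin (closedBall (0 : ℂ) R),
        log ‖f z‖ = ∑ u ∈ S, divisor f Set.univ u * (log ‖z - u‖ - log R) + v z := by
  set U := closedBall (0 : ℂ) R
  have hfin := (divisor f U).finiteSupport (isCompact_closedBall 0 R)
  obtain ⟨h, h₁, h₂, h₃⟩ := (hf.meromorphicOn (s := U)).extract_zeros_poles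
    (fun u ↦ hf' u) hfin
  have hlog := extract_zeros_poles_log h₂ h₃
  have hS : ∀ u ∈ hfin.toFinset, u ∈ U := fun u hu ↦
    (divisor f U).supportWithinDomain (hfin.mem_toFinset.1 hu)
  refine ⟨fun z ↦ log ‖h z‖ + ∑ u ∈ hfin.toFinset, divisor f Set.univ u * log R, hfin.toFinset,
    ?_, fun u hu ↦ by simpa [U] using hS u hu, ?_⟩
  · exact InnerProductSpace.HarmonicOnNhd.add
      (fun x hx ↦ (h₁ x hx).harmonicAt_log_norm (h₂ ⟨x, hx⟩))
      (InnerProductSpace.harmonicOnNhd_const _)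
  · filter_upwards [hlog] with z hz
    rw [hz, Pi.add_apply, finsum_eq_sum_of_support_subset (s := hfin.toFinset), Finset.sum_apply]
    · have : ∀ u ∈ hfin.toFinset, divisor f U u = divisor f Set.univ u := fun u hu ↦ by
        rw [divisor_apply hf.meromorphicOn (hS u hu),
          divisor_apply hf.meromorphicOn (Set.mem_univ u)]
      simp only [mul_sub, Finset.sum_sub_distrib]
      rw [Finset.sum_congr rfl fun u hu ↦ by rw [this u hu]]
      ring
    · intro u hu
      simp only [Set.Finite.coe_toFinset, Function.mem_support]
      intro h0
      apply hu
      ext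
      simp [h0]

/-- From x ≤ y + 3r follows x ≤ 4 max(y, r); the same holds with x and y exchanged. -/
lemma abs_log_norm_sub_log_norm_le {r x y : ℝ} (hr : 0 < r) (hx : 0 < x) (hy : 0 < y)
    (h : |x - y| ≤ 3 * r) :
    |log x - log y| ≤ log 4 + log⁺ (r / x) + log⁺ (r / y) := by
  have aux : ∀ a b : ℝ, 0 < a → 0 < b → a - b ≤ 3 * r → log a - log b ≤ log 4 + log⁺ (r / b) := by
    intro a b ha hb hab
    rw [← log_div ha.ne' hb.ne']
    calc log (a / b) ≤ log⁺ (a / b) := le_max_right _ _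
      _ ≤ log⁺ (4 * max 1 (r / b)) := by
        apply posLog_le_posLog (by positivity)
        rw [div_le_iff₀ hb, mul_assoc, max_mul_of_nonneg _ _ hb.le, div_mul_cancel₀ _ hb.ne']
        have h1 := le_max_left (1 * b) r
        have h2 := le_max_right (1 * b) r
        linarith
      _ ≤ log⁺ 4 + log⁺ (max 1 (r / b)) := posLog_mul
      _ = log 4 + log⁺ (r / b) := by
        rw [posLog_eq_log (by norm_num),
          posLog_eq_log_max_one (x := r / b) (by positivity),
          posLog_eq_log (by rw [le_abs]; exact Or.inl (le_max_left _ _))]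
  rw [abs_le] at *
  have h1 := aux x y hx hy (by linarith)
  have h2 := aux y x hy hx (by linarith)
  have h3 := posLog_nonneg (x := r / x)
  have h4 := posLog_nonneg (x := r / y)
  constructor <;> linarith

/-- Split log|f| on the disk of radius R into a harmonic v and potentials of zeros and poles. Both z
and qz + c have modulus at most 2r ≤ sR, so v varies by O(s) times its mean modulus, while each zero
or pole costs a bounded mean, uniformly in its position. -/
lemma circleAverage_posLog_norm_comp_div_le {f : ℂ → ℂ} (hf : Meromorphic f)
    (hf' : ∀ z, meromorphicOrderAt f z ≠ ⊤) {q c : ℂ} (hq0 : 0 < ‖q‖) (hq1 : ‖q‖ < 1)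
    {r R s : ℝ} (hr : 0 < r) (hc : ‖c‖ ≤ r) (hs0 : 0 ≤ s) (hs : s ≤ 1 / 2) (hR : 2 * r ≤ s * R) :
    ∃ S : Finset ℂ, (∀ u ∈ S, ‖u‖ ≤ R) ∧
    circleAverage (fun z ↦ log⁺ ‖f (q * z + c) / f z‖) 0 r ≤
      8 * s * (circleAverage (fun z ↦ |log ‖f z‖|) 0 R +
        2 * log 2 * ∑ u ∈ S, |(divisor f Set.univ u : ℝ)|) +
      (log 4 + log⁺ ‖q‖⁻¹ + 2 * log 2) * ∑ u ∈ S, |(divisor f Set.univ u : ℝ)| := by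
  have hR0 : 0 < R := by
    by_contra! h
    linarith [mul_nonpos_of_nonneg_of_nonpos hs0 h]
  obtain ⟨v, S, hv, hS, hlog⟩ := exists_harmonic_add_sum_eq_log_norm hf hf' R
  refine ⟨S, hS, ?_⟩
  set D : ℂ → ℝ := fun u ↦ (divisor f Set.univ u : ℝ)
  change circleAverage (fun z ↦ log⁺ ‖f (q * z + c) / f z‖) 0 r ≤
      8 * s * (circleAverage (fun z ↦ |log ‖f z‖|) 0 R + 2 * log 2 * ∑ u ∈ S, |D u|) +
      (log 4 + log⁺ ‖q‖⁻¹ + 2 * log 2) * ∑ u ∈ S, |D u|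
  have hvi : CircleIntegrable v 0 R := by
    apply ContinuousOn.circleIntegrable hR0.le
    exact hv.continuousOn.mono sphere_subset_closedBall
  have hlogi : CircleIntegrable (fun z ↦ log ‖f z‖) 0 R :=
    hf.meromorphicOn.circleIntegrable_log_norm
  have hui : ∀ u, CircleIntegrable (fun z ↦ |log ‖z - u‖ - log R|) 0 R := fun u ↦
    ((circleIntegrable_log_norm_sub_const (a := u) (c := 0) R).sub
      (circleIntegrable_const (log R) 0 R)).abs
  have hui' : ∀ u, CircleIntegrable (fun z ↦ |D u| * |log ‖z - u‖ - log R|) 0 R := fun u ↦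
    (hui u).const_mul _
  have hv_le : circleAverage |v| 0 R ≤
      circleAverage (fun z ↦ |log ‖f z‖|) 0 R + 2 * log 2 * ∑ u ∈ S, |D u| := by
    have hsum : CircleIntegrable (fun z ↦ ∑ u ∈ S, |D u| * |log ‖z - u‖ - log R|) 0 R :=
      CircleIntegrable.fun_sum S fun u _ ↦ hui' u
    calc circleAverage |v| 0 R
      _ ≤ circleAverage (fun z ↦ |log ‖f z‖| + ∑ u ∈ S, |D u| * |log ‖z - u‖ - log R|) 0 R := by
        refine circleAverage_mono_codiscreteWithin hR0.ne' hvi.abs (hlogi.abs.add hsum) ?_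
        rw [abs_of_pos hR0]
        filter_upwards [codiscreteWithin_mono sphere_subset_closedBall hlog] with z hz
        have : v z = log ‖f z‖ - ∑ u ∈ S, D u * (log ‖z - u‖ - log R) := by
          rw [hz]; ring
        rw [Pi.abs_apply, this]
        refine (abs_sub _ _).trans ?_
        gcongr
        refine (Finset.abs_sum_le_sum_abs _ _).trans (le_of_eq ?_)
        simp [abs_mul]
      _ = circleAverage (fun z ↦ |log ‖f z‖|) 0 R +
          ∑ u ∈ S, |D u| * circleAverage (fun z ↦ |log ‖z - u‖ - log R|) 0 R := by
        rw [circleAverage_fun_add (f₁ := fun z ↦ |log ‖f z‖|) hlogi.abs hsum,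
          circleAverage_fun_sum fun u _ ↦ hui' u]
        congr 1
        refine Finset.sum_congr rfl fun u _ ↦ ?_
        simp only [← smul_eq_mul, circleAverage_fun_smul]
      _ ≤ _ := by
        rw [Finset.mul_sum]
        refine add_le_add le_rfl (Finset.sum_le_sum fun u hu ↦ ?_)
        rw [mul_comm]
        refine mul_le_mul_of_nonneg_right ?_ (abs_nonneg _)
        exact circleAverage_abs_log_norm_sub_sub_log_le hR0 (hS u hu)
  have hq : q ≠ 0 := norm_pos_iff.1 hq0
  set φ : ℂ → ℂ := fun z ↦ q * z + c
  have hφ : Function.Injective φ := fun x y h ↦ by simpa [φ, hq] using h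
  -- On a compact disk the decomposition fails at finitely many points only. These, their preimages
  -- under φ, and the singularities at z and φ z are all negligible on the circle.
  have hfin := (isCompact_closedBall (0 : ℂ) R).finite_sdiff_of_mem_codiscreteWithin hlog
  have hgood₁ : ∀ᶠ z in codiscreteWithin (sphere (0 : ℂ) r), z ∉ (closedBall (0 : ℂ) R \
      {z | log ‖f z‖ = ∑ u ∈ S, divisor f Set.univ u * (log ‖z - u‖ - log R) + v z}) :=
    compl_finite_mem_codiscreteWithin hfin
  have hgood₂ : ∀ᶠ z in codiscreteWithin (sphere (0 : ℂ) r), φ z ∉ (closedBall (0 : ℂ) R \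
      {z | log ‖f z‖ = ∑ u ∈ S, divisor f Set.univ u * (log ‖z - u‖ - log R) + v z}) :=
    compl_finite_mem_codiscreteWithin (hfin.preimage hφ.injOn)
  have hgood₃ : ∀ᶠ z in codiscreteWithin (sphere (0 : ℂ) r), z ∉ (S : Set ℂ) :=
    compl_finite_mem_codiscreteWithin S.finite_toSet
  have hgood₄ : ∀ᶠ z in codiscreteWithin (sphere (0 : ℂ) r), φ z ∉ (S : Set ℂ) :=
    compl_finite_mem_codiscreteWithin (S.finite_toSet.preimage hφ.injOn)
  set B := 8 * s * (circleAverage (fun z ↦ |log ‖f z‖|) 0 R + 2 * log 2 * ∑ u ∈ S, |D u|)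
  set L := log 4 + log⁺ ‖q‖⁻¹
  have hpi : ∀ u, CircleIntegrable (fun z ↦ log⁺ (r / ‖z - u‖)) 0 r := fun u ↦
    circleIntegrable_posLog_div_norm_sub r u r
  have hti : ∀ u, CircleIntegrable (fun z ↦ |D u| * (L + log⁺ (r / ‖z - u‖) +
      log⁺ (r / ‖z - (u - c) / q‖))) 0 r := fun u ↦
    (((circleIntegrable_const L 0 r).add (hpi u)).add (hpi ((u - c) / q))).const_mul _
  have hsi : CircleIntegrable (fun z ↦ ∑ u ∈ S, |D u| * (L + log⁺ (r / ‖z - u‖) +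
      log⁺ (r / ‖z - (u - c) / q‖))) 0 r := CircleIntegrable.fun_sum S fun u _ ↦ hti u
  have hmain : circleAverage (fun z ↦ log⁺ ‖f (q * z + c) / f z‖) 0 r ≤
      circleAverage (fun z ↦ B + ∑ u ∈ S, |D u| * (L + log⁺ (r / ‖z - u‖) +
        log⁺ (r / ‖z - (u - c) / q‖))) 0 r := by
    refine circleAverage_mono_codiscreteWithin hr.ne' ?_ ((circleIntegrable_const B 0 r).add hsi) ?_
    · apply MeromorphicOn.circleIntegrable_posLog_norm
      intro z _
      exact ((hf (q * z + c)).comp_analyticAt (f := f) (g := fun z ↦ q * z + c)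
        (by fun_prop)).div (hf z)
    rw [abs_of_pos hr]
    filter_upwards [hgood₁, hgood₂, hgood₃, hgood₄, self_mem_codiscreteWithin _]
      with z h₁ h₂ h₃ h₄ hz
    have hzr : ‖z‖ = r := by simpa using hz
    have hφr : ‖φ z‖ ≤ 2 * r := by
      calc ‖q * z + c‖ ≤ ‖q‖ * ‖z‖ + ‖c‖ := by
            refine (norm_add_le _ _).trans ?_
            rw [norm_mul]
        _ ≤ 1 * r + r := by rw [hzr]; gcongr
        _ = 2 * r := by ring
    have hsR : s * R ≤ R := by nlinarith
    have e₁ : log ‖f z‖ = ∑ u ∈ S, D u * (log ‖z - u‖ - log R) + v z := by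
      by_contra h
      exact h₁ ⟨by simp only [mem_closedBall, dist_zero_right]; linarith, h⟩
    have e₂ : log ‖f (φ z)‖ = ∑ u ∈ S, D u * (log ‖φ z - u‖ - log R) + v (φ z) := by
      by_contra h
      exact h₂ ⟨by simp only [mem_closedBall, dist_zero_right]; linarith, h⟩
    -- If either value vanishes, the quotient is 0, also by the convention x/0 = 0, and its log⁺ is
    -- 0.
    have hle : log⁺ ‖f (φ z) / f z‖ ≤ |log ‖f (φ z)‖ - log ‖f z‖| := by
      by_cases h0 : f z = 0
      · simp [h0]
      by_cases h0' : f (φ z) = 0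
      · simp [h0']
      rw [norm_div, posLog_apply, log_div (by simpa) (by simpa)]
      exact max_le (abs_nonneg _) (le_abs_self _)
    refine hle.trans ?_
    have hv' := abs_harmonic_sub_le hR0 hv hs (z := φ z) (w := z) (by linarith) (by linarith)
    have hB : |v (φ z) - v z| ≤ B :=
      hv'.trans (mul_le_mul_of_nonneg_left hv_le (by positivity))
    have hrw : log ‖f (φ z)‖ - log ‖f z‖ =
        (v (φ z) - v z) + ∑ u ∈ S, D u * (log ‖φ z - u‖ - log ‖z - u‖) := by
      have : ∑ u ∈ S, D u * (log ‖φ z - u‖ - log ‖z - u‖) =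
          ∑ u ∈ S, D u * (log ‖φ z - u‖ - log R) - ∑ u ∈ S, D u * (log ‖z - u‖ - log R) := by
        rw [← Finset.sum_sub_distrib]
        exact Finset.sum_congr rfl fun u _ ↦ by ring
      rw [e₁, e₂, this]; ring
    rw [hrw]
    refine (abs_add_le _ _).trans (add_le_add hB ?_)
    refine (Finset.abs_sum_le_sum_abs _ _).trans (Finset.sum_le_sum fun u hu ↦ ?_)
    rw [abs_mul]
    gcongr
    have p₁ : 0 < ‖z - u‖ := norm_pos_iff.2 (sub_ne_zero.2 fun h ↦ h₃ (h ▸ hu))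
    have p₂ : 0 < ‖φ z - u‖ := norm_pos_iff.2 (sub_ne_zero.2 fun h ↦ h₄ (h ▸ hu))
    have h3r : |‖φ z - u‖ - ‖z - u‖| ≤ 3 * r := by
      refine (abs_norm_sub_norm_le _ _).trans ?_
      rw [sub_sub_sub_cancel_right]
      exact (norm_sub_le _ _).trans (by linarith)
    have h5 := abs_log_norm_sub_log_norm_le hr p₂ p₁ h3r
    have h6 : log⁺ (r / ‖φ z - u‖) ≤ log⁺ ‖q‖⁻¹ + log⁺ (r / ‖z - (u - c) / q‖) := by
      have : φ z - u = q * (z - (u - c) / q) := by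
        simp only [φ]; field_simp; ring
      rw [this, norm_mul, show r / (‖q‖ * ‖z - (u - c) / q‖) =
        ‖q‖⁻¹ * (r / ‖z - (u - c) / q‖) by field_simp]
      exact posLog_mul
    linarith
  refine hmain.trans ?_
  rw [circleAverage_fun_add (circleIntegrable_const B 0 r) hsi, circleAverage_const,
    circleAverage_fun_sum fun u _ ↦ hti u, Finset.mul_sum]
  gcongr with u hu
  simp only [← smul_eq_mul (a := |D u|), circleAverage_fun_smul]
  rw [circleAverage_fun_add (f₁ := fun z ↦ L + log⁺ (r / ‖z - u‖))
    ((circleIntegrable_const L 0 r).add (hpi u)) (hpi _),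
    circleAverage_fun_add (circleIntegrable_const L 0 r) (hpi u), circleAverage_const, smul_eq_mul,
    mul_comm]
  refine mul_le_mul_of_nonneg_right ?_ (abs_nonneg _)
  linarith [circleAverage_posLog_div_norm_sub_le hr u,
    circleAverage_posLog_div_norm_sub_le hr ((u - c) / q)]

end HahnNevanlinna

/-! ### Integrated counting functions as weighted sums -/

namespace HahnNevanlinna

open Real Metric

open Function.locallyFinsuppWithin in
-- The origin needs no separate term: with log 0 = 0 its weight is log r.
lemma logCounting_eq_finsum (D : Function.locallyFinsupp ℂ ℤ) {r : ℝ} (hr : 0 < r) :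
    Function.locallyFinsuppWithin.logCounting D r =
      ∑ᶠ z, (D z : ℝ) * if ‖z‖ ≤ r then log r - log ‖z‖ else 0 := by
  have h := countingFunction_finsum_eq_finsum_add (c := 0) (R := r) (D := toClosedBall r D) hr.ne'
    ((toClosedBall r D).finiteSupport (isCompact_closedBall 0 |r|))
  simp only [Function.locallyFinsuppWithin.logCounting, AddMonoidHom.coe_mk, ZeroHom.coe_mk]
  have h0 : toClosedBall r D 0 = D 0 := toClosedBall_eval_within D (by simp)
  simp only [zero_sub, norm_neg, h0] at h
  rw [← h]
  refine finsum_congr fun z ↦ ?_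
  split_ifs with hz
  · rw [toClosedBall_eval_within D (by simpa [abs_of_pos hr] using hz)]
  · rw [Function.locallyFinsuppWithin.apply_eq_zero_of_notMem _
      (by simpa [abs_of_pos hr] using hz)]
    simp

lemma finite_support_mul_of_bounded (D : Function.locallyFinsupp ℂ ℤ) {w : ℂ → ℝ} {r : ℝ}
    (hw : ∀ z, r < ‖z‖ → w z = 0) : (Function.support fun z ↦ (D z : ℝ) * w z).Finite := by
  refine (D.locallyFiniteSupport.finite_inter_support_of_isCompact
    (isCompact_closedBall 0 r)).subset fun z hz ↦ ?_
  simp only [Function.mem_support, ne_eq, mul_eq_zero, Int.cast_eq_zero, not_or] at hz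
  refine ⟨?_, hz.1⟩
  by_contra h
  exact hz.2 (hw z (by simpa using h))

lemma logWeight_nonneg {r : ℝ} (hr : 1 ≤ r) (z : ℂ) :
    0 ≤ if ‖z‖ ≤ r then log r - log ‖z‖ else 0 := by
  split_ifs with h
  · rcases eq_or_ne z 0 with rfl | hz
    · simpa using log_nonneg hr
    · exact sub_nonneg.2 (log_le_log (norm_pos_iff.2 hz) h)
  · rfl

/-- A point of modulus at most R has weight at least log(KR) - log R = log K at radius KR, or
log(KR) at the origin. -/
lemma sum_mul_log_le_logCounting {D : Function.locallyFinsupp ℂ ℤ} (hD : 0 ≤ D) {S : Finset ℂ}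
    {R K : ℝ} (hR : 1 ≤ R) (hK : 1 ≤ K) (hS : ∀ u ∈ S, ‖u‖ ≤ R) :
    (∑ u ∈ S, (D u : ℝ)) * log K ≤ Function.locallyFinsuppWithin.logCounting D (K * R) := by
  have hKR : 1 ≤ K * R := one_le_mul_of_one_le_of_one_le hK hR
  rw [logCounting_eq_finsum D (by linarith)]
  set w : ℂ → ℝ := fun z ↦ if ‖z‖ ≤ K * R then log (K * R) - log ‖z‖ else 0
  have hfin : (Function.support fun z ↦ (D z : ℝ) * w z).Finite :=
    finite_support_mul_of_bounded D fun z hz ↦ if_neg hz.not_ge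
  classical
  change _ ≤ ∑ᶠ z, (D z : ℝ) * w z
  rw [finsum_eq_sum_of_support_subset (s := hfin.toFinset ∪ S) _ (by simp), Finset.sum_mul]
  have hD' : ∀ z, (0 : ℝ) ≤ D z := fun z ↦ Int.cast_nonneg (hD z)
  refine le_trans (Finset.sum_le_sum fun u hu ↦ ?_)
    (Finset.sum_le_sum_of_subset_of_nonneg Finset.subset_union_right
      fun z _ _ ↦ mul_nonneg (hD' z) (logWeight_nonneg hKR z))
  refine mul_le_mul_of_nonneg_left ?_ (hD' u)
  have h1 : ‖u‖ ≤ K * R := (hS u hu).trans (le_mul_of_one_le_left (by linarith) hK)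
  simp only [w, if_pos h1]
  rw [log_mul (by linarith) (by linarith)]
  rcases eq_or_ne u 0 with rfl | hz
  · simpa using log_nonneg hR
  · linarith [log_le_log (norm_pos_iff.2 hz) (hS u hu)]

/-- Beyond R₀ one has |qz + c| ≤ |z|, so moving a point by the affine map only increases its weight.
The finitely many points of D' inside R₀ contribute the constant, the correction e bounding the
change of weight there. -/
lemma exists_logCounting_comp_affine_le {D D' : Function.locallyFinsupp ℂ ℤ} (hD : 0 ≤ D)
    {q c : ℂ} (hq0 : 0 < ‖q‖) (hq1 : ‖q‖ < 1) (h : ∀ z, D' z = D (q * z + c)) :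
    ∃ C, ∀ᶠ r in atTop, Function.locallyFinsuppWithin.logCounting D' r ≤
      Function.locallyFinsuppWithin.logCounting D r + C := by
  have hq : q ≠ 0 := norm_pos_iff.1 hq0
  let φ : ℂ ≃ ℂ := (Equiv.mulLeft₀ q hq).trans (Equiv.addRight c)
  have hφ : ∀ z, φ z = q * z + c := fun z ↦ rfl
  set R₀ : ℝ := max 1 (‖c‖ / (1 - ‖q‖))
  have hR₀ : ‖c‖ ≤ (1 - ‖q‖) * R₀ := by
    rw [← div_le_iff₀' (by linarith)]
    exact le_max_right _ _
  have hR₁ : 1 ≤ R₀ := le_max_left _ _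
  have hφle : ∀ z, ‖φ z‖ ≤ ‖q‖ * ‖z‖ + ‖c‖ := fun z ↦ by
    rw [hφ, ← norm_mul]; exact norm_add_le _ _
  set w : ℝ → ℂ → ℝ := fun r z ↦ if ‖z‖ ≤ r then log r - log ‖z‖ else 0
  set e : ℂ → ℝ := fun z ↦ if ‖z‖ ≤ R₀ then |log ‖z‖| + |log ‖φ z‖| else 0
  have hD' : ∀ z, (0 : ℝ) ≤ D' z := fun z ↦ by rw [h z]; exact Int.cast_nonneg (hD _)
  refine ⟨∑ᶠ z, (D' z : ℝ) * e z, ?_⟩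
  filter_upwards [eventually_ge_atTop R₀] with r hr
  have hr1 : 1 ≤ r := hR₁.trans hr
  have hrpos : 0 < r := by linarith
  rw [logCounting_eq_finsum D hrpos, logCounting_eq_finsum D' hrpos]
  change ∑ᶠ z, (D' z : ℝ) * w r z ≤ ∑ᶠ z, (D z : ℝ) * w r z + _
  have hcomp : ∑ᶠ z, (D z : ℝ) * w r z = ∑ᶠ z, (D' z : ℝ) * w r (φ z) := by
    rw [← finsum_comp_equiv φ]
    exact finsum_congr fun z ↦ by rw [h z, hφ]
  have f₁ : (Function.support fun z ↦ (D' z : ℝ) * w r z).Finite :=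
    finite_support_mul_of_bounded D' fun z hz ↦ if_neg hz.not_ge
  have f₂ : (Function.support fun z ↦ (D' z : ℝ) * w r (φ z)).Finite := by
    have : (Function.support fun z ↦ (D z : ℝ) * w r z).Finite :=
      finite_support_mul_of_bounded D fun z hz ↦ if_neg hz.not_ge
    refine (this.preimage φ.injective.injOn).subset fun z hz ↦ ?_
    simpa only [Set.mem_preimage, Function.mem_support, hφ, ← h z] using hz
  have f₃ : (Function.support fun z ↦ (D' z : ℝ) * e z).Finite :=
    finite_support_mul_of_bounded D' fun z hz ↦ if_neg hz.not_ge
  rw [hcomp, ← finsum_add_distrib f₂ f₃]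
  refine finsum_le_finsum' f₁ (f₂.union f₃ |>.subset (Function.support_add _ _)) fun z ↦ ?_
  rw [← mul_add]
  refine mul_le_mul_of_nonneg_left ?_ (hD' z)
  by_cases hz : ‖z‖ ≤ R₀
  · have h1 : ‖φ z‖ ≤ r := (hφle z).trans (by nlinarith)
    simp only [w, e, if_pos hz, if_pos h1, if_pos (hz.trans hr)]
    have := neg_abs_le (log ‖z‖)
    have := le_abs_self (log ‖φ z‖)
    linarith
  · push Not at hz
    have h1 : ‖φ z‖ ≤ ‖z‖ := (hφle z).trans (by nlinarith)
    have he : e z = 0 := if_neg hz.not_ge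
    rw [he, add_zero]
    by_cases hzr : ‖z‖ ≤ r
    · simp only [w, if_pos hzr, if_pos (h1.trans hzr)]
      rcases eq_or_ne (φ z) 0 with h0 | h0
      · rw [h0]
        simpa using log_nonneg (hR₁.trans hz.le)
      · linarith [log_le_log (norm_pos_iff.2 h0) h1]
    · simp only [w, if_neg hzr]
      exact logWeight_nonneg hr1 _

end HahnNevanlinna

/-! ### The quotient estimate in terms of the characteristic -/

namespace HahnNevanlinna

open Real Metric

lemma characteristic_inv_le {f : ℂ → ℂ} (hf : Meromorphic f) :
    ∃ C, 0 ≤ C ∧ ∀ r, |characteristic f ⊤ r - characteristic f⁻¹ ⊤ r| ≤ C :=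
  ⟨_, le_max_of_le_left (abs_nonneg _), fun _ ↦ characteristic_sub_characteristic_inv_le hf⟩

lemma circleAverage_abs_log_norm_eq {f : ℂ → ℂ} (hf : Meromorphic f) (r : ℝ) :
    circleAverage (fun z ↦ |log ‖f z‖|) 0 r = proximity f ⊤ r + proximity f⁻¹ ⊤ r := by
  rw [proximity_top, proximity_top, ← circleAverage_fun_add
    hf.meromorphicOn.circleIntegrable_posLog_norm
    hf.inv.meromorphicOn.circleIntegrable_posLog_norm]
  congr 1
  ext z
  rw [Pi.inv_apply, norm_inv, posLog_apply, posLog_apply, log_inv]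
  rcases le_total 0 (log ‖f z‖) with h | h
  · rw [abs_of_nonneg h, max_eq_right h, max_eq_left (by linarith), add_zero]
  · rw [abs_of_nonpos h, max_eq_left h, max_eq_right (by linarith), zero_add]

lemma proximity_le_characteristic {f : ℂ → ℂ} {a : WithTop ℂ} {r : ℝ} (hr : 1 ≤ r) :
    proximity f a r ≤ characteristic f a r :=
  le_add_of_nonneg_right (logCounting_nonneg hr)

lemma logCounting_le_characteristic {f : ℂ → ℂ} {a : WithTop ℂ} {r : ℝ} :
    logCounting f a r ≤ characteristic f a r :=
  le_add_of_nonneg_left (proximity_nonneg r)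

/-- The number of zeros and poles in a disk is controlled by the characteristic. -/
lemma sum_abs_divisor_mul_log_le {f : ℂ → ℂ} {S : Finset ℂ} {R K : ℝ}
    (hR : 1 ≤ R) (hK : 1 ≤ K) (hS : ∀ u ∈ S, ‖u‖ ≤ R) :
    (∑ u ∈ S, |(divisor f Set.univ u : ℝ)|) * log K ≤
      characteristic f ⊤ (K * R) + characteristic f⁻¹ ⊤ (K * R) := by
  have h₁ := sum_mul_log_le_logCounting (posPart_nonneg (divisor f Set.univ)) hR hK hS
  have h₂ := sum_mul_log_le_logCounting (negPart_nonneg (divisor f Set.univ)) hR hK hS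
  rw [← logCounting_zero, ← logCounting_inv] at h₁
  rw [← logCounting_top] at h₂
  have h₃ : ∑ u ∈ S, |(divisor f Set.univ u : ℝ)| =
      ∑ u ∈ S, ((divisor f Set.univ)⁺ u : ℝ) + ∑ u ∈ S, ((divisor f Set.univ)⁻ u : ℝ) := by
    rw [← Finset.sum_add_distrib]
    refine Finset.sum_congr rfl fun u _ ↦ ?_
    rw [Function.locallyFinsuppWithin.posPart_apply, Function.locallyFinsuppWithin.negPart_apply]
    have := posPart_add_negPart (divisor f Set.univ u)
    rw [← Int.cast_add, this, Int.cast_abs]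
  rw [h₃, add_mul]
  linarith [logCounting_le_characteristic (f := f) (a := ⊤) (r := K * R),
    logCounting_le_characteristic (f := f⁻¹) (a := ⊤) (r := K * R)]

/-- Affine analogue of the lemma on the logarithmic derivative. -/
theorem exists_circleAverage_posLog_comp_div_le {f : ℂ → ℂ} (hf : Meromorphic f)
    (hf' : ∀ z, meromorphicOrderAt f z ≠ ⊤) {q c : ℂ} (hq0 : 0 < ‖q‖) (hq1 : ‖q‖ < 1)
    {η : ℝ} (hη : 0 < η) :
    ∀ᶠ k : ℝ in atTop, ∃ C, ∀ᶠ r in atTop,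
      circleAverage (fun z ↦ log⁺ ‖f (q * z + c) / f z‖) 0 r ≤
        η * characteristic f ⊤ (k * (k * r)) + C := by
  obtain ⟨C₀, hC₀, hinv⟩ := characteristic_inv_le hf
  set L := log 4 + log⁺ ‖q‖⁻¹ + 2 * log 2
  have hL : 0 ≤ L := by
    have := posLog_nonneg (x := ‖q‖⁻¹)
    positivity
  set M := 8 * log 2 + L
  have hM : 0 ≤ M := by positivity
  -- With s = 2/k, the harmonic part yields 32/k. Counting zeros and poles in radius kr by means of
  -- the characteristic at k²r yields 2M/log k.
  have hlim : Tendsto (fun k : ℝ ↦ 32 * k⁻¹ + 2 * M * (log k)⁻¹) atTop (𝓝 (32 * 0 + 2 * M * 0)) :=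
    (tendsto_inv_atTop_zero.const_mul _).add
      ((tendsto_inv_atTop_zero.comp tendsto_log_atTop).const_mul _)
  filter_upwards [hlim.eventually_le_const (u := η) (by simpa using hη), eventually_ge_atTop 4]
    with k hk hk4
  refine ⟨(16 * k⁻¹ + M * (log k)⁻¹) * C₀, ?_⟩
  filter_upwards [eventually_ge_atTop 1, eventually_ge_atTop ‖c‖] with r hr hrc
  have hkr : 1 ≤ k * r := by nlinarith
  have hkkr : k * r ≤ k * (k * r) := by nlinarith
  have hk0 : 0 < k := by linarith
  have hlogk : 0 < log k := log_pos (by linarith)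
  have hs : 2 * k⁻¹ ≤ 1 / 2 := by
    rw [← div_eq_mul_inv, div_le_iff₀ hk0]; linarith
  obtain ⟨S, hS, hle⟩ := circleAverage_posLog_norm_comp_div_le hf hf' hq0 hq1
    (r := r) (R := k * r) (s := 2 * k⁻¹) (by linarith) hrc (by positivity) hs
    (by field_simp; rfl)
  have hn := sum_abs_divisor_mul_log_le (f := f) hkr (by linarith : 1 ≤ k) hS
  set n := ∑ u ∈ S, |(divisor f Set.univ u : ℝ)|
  have hn0 : 0 ≤ n := Finset.sum_nonneg fun _ _ ↦ abs_nonneg _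
  set T := characteristic f ⊤ (k * (k * r))
  have h₁ := abs_le.1 (hinv (k * (k * r)))
  have h₂ := abs_le.1 (hinv (k * r))
  have hmono : characteristic f ⊤ (k * r) ≤ T :=
    characteristic_monotoneOn hf (Set.mem_Ioi.2 (by linarith)) (Set.mem_Ioi.2 (by linarith)) hkkr
  have hA : circleAverage (fun z ↦ |log ‖f z‖|) 0 (k * r) ≤ 2 * T + C₀ := by
    rw [circleAverage_abs_log_norm_eq hf]
    linarith [proximity_le_characteristic (f := f) (a := ⊤) hkr,
      proximity_le_characteristic (f := f⁻¹) (a := ⊤) hkr]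
  have hn' : n ≤ (2 * T + C₀) * (log k)⁻¹ := by
    rw [← div_eq_mul_inv, le_div_iff₀ hlogk]
    linarith
  have hT : 0 ≤ T := characteristic_nonneg (by linarith)
  calc _ ≤ 8 * (2 * k⁻¹) * (circleAverage (fun z ↦ |log ‖f z‖|) 0 (k * r) + 2 * log 2 * n) +
        L * n := hle
    _ ≤ 16 * k⁻¹ * (2 * T + C₀) + M * n := by
      have h3 : 8 * (2 * k⁻¹) * (2 * log 2 * n) ≤ 8 * (1 / 2) * (2 * log 2 * n) := by gcongr
      have h4 : 16 * k⁻¹ * circleAverage (fun z ↦ |log ‖f z‖|) 0 (k * r) ≤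
        16 * k⁻¹ * (2 * T + C₀) := by gcongr
      simp only [M]
      linarith
    _ ≤ 16 * k⁻¹ * (2 * T + C₀) + M * ((2 * T + C₀) * (log k)⁻¹) := by gcongr
    _ = (32 * k⁻¹ + 2 * M * (log k)⁻¹) * T + (16 * k⁻¹ + M * (log k)⁻¹) * C₀ := by ring
    _ ≤ _ := by gcongr

end HahnNevanlinna

/-! ### Local orders of the Hahn difference -/

namespace HahnNevanlinna

section Orders

variable {q c : ℂ} {f g : ℂ → ℂ} {z : ℂ}

lemma meromorphic_comp_affine (hf : Meromorphic f) (q c : ℂ) :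
    Meromorphic fun z ↦ f (q * z + c) := fun z ↦
  (hf (q * z + c)).comp_analyticAt (f := f) (g := fun z ↦ q * z + c) (by fun_prop)

lemma meromorphic_hahnDiff (hf : Meromorphic f) (q c : ℂ) : Meromorphic (hahnDiff q c f) := fun z ↦
  ((meromorphic_comp_affine hf q c z).sub (hf z)).div (by fun_prop)

lemma meromorphicOrderAt_comp_affine (hq : q ≠ 0) (f : ℂ → ℂ) (z : ℂ) :
    meromorphicOrderAt (fun z ↦ f (q * z + c)) z = meromorphicOrderAt f (q * z + c) := by
  have hd : HasDerivAt (fun z : ℂ ↦ q * z + c) q z := by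
    simpa using ((hasDerivAt_id z).const_mul q).add_const c
  exact meromorphicOrderAt_comp_of_deriv_ne_zero (f := f) (g := fun z ↦ q * z + c) (by fun_prop)
    (by rwa [hd.deriv])

lemma meromorphicOrderAt_affine_of_ne (h : (q - 1) * z + c ≠ 0) :
    meromorphicOrderAt (fun z ↦ (q - 1) * z + c) z = 0 := by
  have ha : AnalyticAt ℂ (fun z ↦ (q - 1) * z + c) z := by fun_prop
  rw [ha.meromorphicOrderAt_eq, ha.analyticOrderAt_eq_zero.2 h]
  rfl

lemma meromorphicOrderAt_affine_of_eq (hq : q ≠ 1) (h : (q - 1) * z + c = 0) :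
    meromorphicOrderAt (fun z ↦ (q - 1) * z + c) z = 1 := by
  have ha : MeromorphicAt (fun z ↦ (q - 1) * z + c) z := by fun_prop
  refine (meromorphicOrderAt_eq_int_iff ha (n := 1)).2
    ⟨fun _ ↦ q - 1, analyticAt_const, sub_ne_zero.2 hq, ?_⟩
  filter_upwards with w
  rw [zpow_one, smul_eq_mul]
  linear_combination h

lemma meromorphicOrderAt_hahnDiff (hf : Meromorphic f) (q c z : ℂ) :
    meromorphicOrderAt (hahnDiff q c f) z =
      meromorphicOrderAt ((fun z ↦ f (q * z + c)) - f) z -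
        meromorphicOrderAt (fun z ↦ (q - 1) * z + c) z :=
  meromorphicOrderAt_div ((meromorphic_comp_affine hf q c z).sub (hf z)) (by fun_prop)

/-- Only the fixed point of z ↦ qz + c needs care. The denominator has a simple zero there, but f(qw
+ c) and f(w) have the same limit, so the numerator vanishes too. -/
lemma meromorphicOrderAt_hahnDiff_nonneg (hf : Meromorphic f) (hq0 : q ≠ 0) (hq1 : q ≠ 1)
    (h₁ : 0 ≤ meromorphicOrderAt f z) (h₂ : 0 ≤ meromorphicOrderAt f (q * z + c)) :
    0 ≤ meromorphicOrderAt (hahnDiff q c f) z := by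
  rw [meromorphicOrderAt_hahnDiff hf]
  have hfq := meromorphic_comp_affine hf q c z
  rw [← meromorphicOrderAt_comp_affine hq0] at h₂
  by_cases h : (q - 1) * z + c = 0
  · rw [meromorphicOrderAt_affine_of_eq hq1 h]
    obtain ⟨L, hL⟩ := (tendsto_nhds_iff_meromorphicOrderAt_nonneg (hf z)).2 h₁
    have hz : q * z + c = z := by linear_combination h
    have hφ : Tendsto (fun w : ℂ ↦ q * w + c) (𝓝[≠] z) (𝓝[≠] z) := by
      apply tendsto_nhdsWithin_of_tendsto_nhds_of_eventually_within
      · have : Tendsto (fun w : ℂ ↦ q * w + c) (𝓝 z) (𝓝 (q * z + c)) :=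
          Continuous.tendsto (by fun_prop) z
        rw [hz] at this
        exact this.mono_left nhdsWithin_le_nhds
      · filter_upwards [self_mem_nhdsWithin] with w hw hw'
        apply hw
        have : q * (w - z) = 0 := by
          have : q * w + c = z := hw'
          linear_combination this - hz
        simpa [hq0, sub_eq_zero] using this
    have h3 : Tendsto ((fun w ↦ f (q * w + c)) - f) (𝓝[≠] z) (𝓝 0) := by
      rw [← sub_self L]
      exact (hL.comp hφ).sub hL
    have h4 := (tendsto_zero_iff_meromorphicOrderAt_pos (hfq.sub (hf z))).1 h3
    cases h5 : meromorphicOrderAt ((fun w ↦ f (q * w + c)) - f) z with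
    | top => simp
    | coe n =>
      rw [h5] at h4
      norm_cast at h4 ⊢
      have : (0 : ℤ) ≤ n - 1 := by
        have : (0 : ℤ) < n := by exact_mod_cast h4
        omega
      exact_mod_cast this
  · rw [meromorphicOrderAt_affine_of_ne h, sub_zero, sub_eq_add_neg]
    refine le_trans (le_min h₂ ?_) (meromorphicOrderAt_add hfq (hf z).neg)
    rwa [← meromorphicOrderAt_neg]

lemma meromorphicOrderAt_hahnDiff_of_ne (hf : Meromorphic f) (hq0 : q ≠ 0)
    (h : meromorphicOrderAt f z ≠ meromorphicOrderAt f (q * z + c)) :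
    meromorphicOrderAt (hahnDiff q c f) z =
      min (meromorphicOrderAt f z) (meromorphicOrderAt f (q * z + c)) := by
  have hz : (q - 1) * z + c ≠ 0 := fun h0 ↦ h (by
    rw [show q * z + c = z by linear_combination h0])
  rw [meromorphicOrderAt_hahnDiff hf, meromorphicOrderAt_affine_of_ne hz, sub_zero, sub_eq_add_neg,
    meromorphicOrderAt_add_of_ne (meromorphic_comp_affine hf q c z) (hf z).neg,
    ← meromorphicOrderAt_neg, meromorphicOrderAt_comp_affine hq0, min_comm]
  rw [← meromorphicOrderAt_neg, meromorphicOrderAt_comp_affine hq0]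
  exact h.symm

/-- With f(w) = (w-z)ⁿ h₀(w) near the fixed point, invariance would give qⁿ h₀(z) = h₀(z), so |q|ⁿ =
1, which forces n = 0. -/
lemma meromorphicOrderAt_comp_affine_sub_ne_top (hf : MeromorphicAt f z)
    (hq0 : 0 < ‖q‖) (hq1 : ‖q‖ < 1) (hz : q * z + c = z)
    (h₁ : meromorphicOrderAt f z ≠ ⊤) (h₂ : meromorphicOrderAt f z ≠ 0) :
    ¬ (∀ᶠ w in 𝓝[≠] z, f (q * w + c) = f w) := by
  intro h
  have hq : q ≠ 0 := norm_pos_iff.1 hq0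
  obtain ⟨h₀, ha, h0, heq⟩ := (meromorphicOrderAt_ne_top_iff hf).1 h₁
  set n := (meromorphicOrderAt f z).untop₀
  have hn : n ≠ 0 := fun hn ↦ h₂ (by
    rw [← WithTop.coe_untop₀_of_ne_top h₁]; exact_mod_cast hn)
  have hφ0 : Tendsto (fun w : ℂ ↦ q * w + c) (𝓝[≠] z) (𝓝 z) := by
    have : Tendsto (fun w : ℂ ↦ q * w + c) (𝓝 z) (𝓝 (q * z + c)) :=
      Continuous.tendsto (by fun_prop) z
    rw [hz] at this
    exact this.mono_left nhdsWithin_le_nhds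
  have hφ : Tendsto (fun w : ℂ ↦ q * w + c) (𝓝[≠] z) (𝓝[≠] z) := by
    apply tendsto_nhdsWithin_of_tendsto_nhds_of_eventually_within _ hφ0
    filter_upwards [self_mem_nhdsWithin] with w hw hw'
    apply hw
    have : q * (w - z) = 0 := by
      have : q * w + c = z := hw'
      linear_combination this - hz
    simpa [hq, sub_eq_zero] using this
  have heq' := hφ.eventually heq
  have key : ∀ᶠ w in 𝓝[≠] z, q ^ n * h₀ (q * w + c) = h₀ w := by
    filter_upwards [h, heq, heq', self_mem_nhdsWithin] with w h1 h2 h3 h4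
    have h5 : (w - z) ^ n ≠ 0 := zpow_ne_zero _ (sub_ne_zero.2 h4)
    rw [h1, h2, show q * w + c - z = q * (w - z) by linear_combination hz, mul_zpow,
      smul_eq_mul, smul_eq_mul] at h3
    apply mul_left_cancel₀ h5
    rw [h3]; ring
  have l₁ : Tendsto (fun w ↦ q ^ n * h₀ (q * w + c)) (𝓝[≠] z) (𝓝 (q ^ n * h₀ z)) :=
    (ha.continuousAt.tendsto.comp hφ0).const_mul _
  have l₂ : Tendsto h₀ (𝓝[≠] z) (𝓝 (h₀ z)) := ha.continuousAt.tendsto.mono_left nhdsWithin_le_nhds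
  have e := tendsto_nhds_unique (l₁.congr' key) l₂
  have : q ^ n = 1 := mul_right_cancel₀ h0 (by rw [e, one_mul])
  have h6 : ‖q‖ ^ n = 1 := by rw [← norm_zpow, this, norm_one]
  exact hn ((zpow_eq_one_iff_right₀ hq0.le hq1.ne).1 h6)

lemma NonConstant.meromorphicOrderAt_sub_ne_top (hg : Meromorphic g) (h : NonConstant g) (a z : ℂ) :
    meromorphicOrderAt (g · - a) z ≠ ⊤ := by
  intro htop
  have hm : Meromorphic (g · - a) := fun z ↦ (hg z).sub (MeromorphicAt.const a z)
  apply h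
  refine ⟨a, ?_⟩
  have hall : ∀ w, meromorphicOrderAt (g · - a) w = ⊤ := by
    by_contra! hne
    exact hm.exists_meromorphicOrderAt_ne_top_iff_forall.1 hne z htop
  have : {x | g x = a} ∈ codiscrete ℂ := by
    rw [codiscrete, mem_codiscreteWithin_iff_forall_mem_nhdsNE]
    intro w _
    filter_upwards [meromorphicOrderAt_eq_top_iff.1 (hall w)] with x hx
    exact Or.inl (sub_eq_zero.1 hx)
  exact this

lemma NonConstant.meromorphicOrderAt_ne_top (hg : Meromorphic g) (h : NonConstant g) (z : ℂ) :
    meromorphicOrderAt g z ≠ ⊤ := by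
  simpa using h.meromorphicOrderAt_sub_ne_top hg 0 z

lemma exists_meromorphicOrderAt_sub_pos (hg : MeromorphicAt g z)
    (h : 0 ≤ meromorphicOrderAt g z) : ∃ a, 0 < meromorphicOrderAt (g · - a) z := by
  obtain ⟨a, ha⟩ := (tendsto_nhds_iff_meromorphicOrderAt_nonneg hg).2 h
  refine ⟨a, (tendsto_zero_iff_meromorphicOrderAt_pos (hg.sub (MeromorphicAt.const a z))).1 ?_⟩
  rw [← sub_self a]
  exact ha.sub_const a

/-- By the identity principle it suffices to look at the fixed point c/(1-q). Unless g has a pole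
there, subtracting its limit makes the order nonzero. -/
lemma NonConstant.meromorphicOrderAt_hahnDiff_ne_top (hg : Meromorphic g) (h : NonConstant g)
    (hq0 : 0 < ‖q‖) (hq1 : ‖q‖ < 1) (z : ℂ) : meromorphicOrderAt (hahnDiff q c g) z ≠ ⊤ := by
  have hq : q ≠ 1 := by rintro rfl; simp at hq1
  refine (meromorphic_hahnDiff hg q c).exists_meromorphicOrderAt_ne_top_iff_forall.1
    ⟨c / (1 - q), fun htop ↦ ?_⟩ z
  have h1q : 1 - q ≠ 0 := sub_ne_zero.2 hq.symm
  set z₀ := c / (1 - q)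
  have hz₀ : q * z₀ + c = z₀ := by
    simp only [z₀]; field_simp; ring
  have hev : ∀ᶠ w in 𝓝[≠] z₀, g (q * w + c) = g w := by
    filter_upwards [meromorphicOrderAt_eq_top_iff.1 htop, self_mem_nhdsWithin] with w hw hw'
    rw [hahnDiff, div_eq_zero_iff, sub_eq_zero] at hw
    refine hw.resolve_right fun h0 ↦ hw' ?_
    have : (1 - q) * (w - z₀) = 0 := by linear_combination -h0 + hz₀
    simpa [h1q, sub_eq_zero] using this
  by_cases h0 : meromorphicOrderAt g z₀ < 0
  · exact meromorphicOrderAt_comp_affine_sub_ne_top (hg z₀) hq0 hq1 hz₀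
      (h.meromorphicOrderAt_ne_top hg z₀) h0.ne hev
  · obtain ⟨a, ha⟩ := exists_meromorphicOrderAt_sub_pos (hg z₀) (not_lt.1 h0)
    refine meromorphicOrderAt_comp_affine_sub_ne_top
      ((hg z₀).sub (MeromorphicAt.const a z₀)) hq0 hq1 hz₀
      (h.meromorphicOrderAt_sub_ne_top hg a z₀) ha.ne' ?_
    filter_upwards [hev] with w hw
    simp [hw]

/-- Away from zeros and poles, D(1/g) = -Dg / (g · g∘φ) with φ(z) = qz + c. -/
lemma NonConstant.meromorphicOrderAt_hahnDiff_inv (hg : Meromorphic g) (h : NonConstant g)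
    (hq0 : q ≠ 0) (z : ℂ) :
    meromorphicOrderAt (hahnDiff q c g⁻¹) z =
      meromorphicOrderAt (hahnDiff q c g) z + -meromorphicOrderAt g z +
        -meromorphicOrderAt g (q * z + c) := by
  have hgq := meromorphic_comp_affine hg q c z
  rw [← meromorphicOrderAt_comp_affine hq0, ← meromorphicOrderAt_inv, ← meromorphicOrderAt_inv,
    meromorphicOrderAt_neg (f := hahnDiff q c g),
    ← meromorphicOrderAt_mul (meromorphic_hahnDiff hg q c z).neg (hg z).inv,
    ← meromorphicOrderAt_mul ((meromorphic_hahnDiff hg q c z).neg.mul (hg z).inv) hgq.inv]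
  apply meromorphicOrderAt_congr
  have h₁ := (meromorphicOrderAt_ne_top_iff_eventually_ne_zero (hg z)).1
    (h.meromorphicOrderAt_ne_top hg z)
  have h₂ := (meromorphicOrderAt_ne_top_iff_eventually_ne_zero hgq).1
    (by rw [meromorphicOrderAt_comp_affine hq0]; exact h.meromorphicOrderAt_ne_top hg _)
  filter_upwards [h₁, h₂] with w hw₁ hw₂
  simp only [hahnDiff, Pi.inv_apply, Pi.mul_apply, Pi.neg_apply]
  field_simp
  ring

end Orders

/-- Let o, o', d be the orders of g at z, of g at qz + c, and of Dg at z; then D(1/g) has order d -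
o - o'. If o ≠ o', then d = min(o, o') and equality holds. If o = o' ≥ 0, there are no poles. If o =
o' < 0, the removed part is at most both -o and d - 2o, which covers either sign of d. -/
lemma NonConstant.negPart_divisor_hahnDiff_add_le {g : ℂ → ℂ} (hg : Meromorphic g)
    (h : NonConstant g) {q c : ℂ} (hq0 : 0 < ‖q‖) (hq1 : ‖q‖ < 1) :
    (divisor (hahnDiff q c g) Set.univ)⁻ +
        (divisor g Set.univ)⁻ ⊓ (divisor (hahnDiff q c g⁻¹) Set.univ)⁺ ≤
      (divisor g Set.univ)⁻ + (divisor (fun z ↦ g (q * z + c)) Set.univ)⁻ := by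
  have hq : q ≠ 0 := norm_pos_iff.1 hq0
  have hq' : q ≠ 1 := by rintro rfl; simp at hq1
  rw [Function.locallyFinsuppWithin.le_def]
  intro z
  simp only [Function.locallyFinsuppWithin.coe_add, Pi.add_apply,
    Function.locallyFinsuppWithin.negPart_apply, Function.locallyFinsuppWithin.min_apply,
    Function.locallyFinsuppWithin.posPart_apply]
  rw [divisor_apply (meromorphic_hahnDiff hg q c).meromorphicOn (Set.mem_univ z),
    divisor_apply hg.meromorphicOn (Set.mem_univ z),
    divisor_apply (meromorphic_hahnDiff hg.inv q c).meromorphicOn (Set.mem_univ z),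
    divisor_apply (meromorphic_comp_affine hg q c).meromorphicOn (Set.mem_univ z),
    meromorphicOrderAt_comp_affine hq]
  have he := h.meromorphicOrderAt_hahnDiff_inv hg hq (c := c) z
  have hd₁ := meromorphicOrderAt_hahnDiff_nonneg (c := c) (z := z) hg hq hq'
  have hd₂ := meromorphicOrderAt_hahnDiff_nonneg (c := c) (z := z) hg.inv hq hq'
  have hd₃ := meromorphicOrderAt_hahnDiff_of_ne (c := c) (z := z) hg hq
  rw [meromorphicOrderAt_inv, meromorphicOrderAt_inv] at hd₂
  obtain ⟨d, hd⟩ := WithTop.ne_top_iff_exists.1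
    (h.meromorphicOrderAt_hahnDiff_ne_top hg hq0 hq1 (c := c) z)
  obtain ⟨o, ho⟩ := WithTop.ne_top_iff_exists.1 (h.meromorphicOrderAt_ne_top hg z)
  obtain ⟨o', ho'⟩ := WithTop.ne_top_iff_exists.1 (h.meromorphicOrderAt_ne_top hg (q * z + c))
  rw [← hd, ← ho, ← ho'] at he hd₃
  rw [← hd, ← ho, ← ho'] at hd₁
  rw [← ho, ← ho'] at hd₂
  rw [← hd, ← ho, ← ho']
  have he' : meromorphicOrderAt (hahnDiff q c g⁻¹) z = ((d + -o + -o' : ℤ) : WithTop ℤ) := by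
    rw [he]; rfl
  rw [he'] at hd₂ ⊢
  have k₁ : 0 ≤ o → 0 ≤ o' → 0 ≤ d := fun h1 h2 ↦
    WithTop.coe_le_coe.1 (hd₁ (WithTop.coe_le_coe.2 h1) (WithTop.coe_le_coe.2 h2))
  have k₂ : 0 ≤ -o → 0 ≤ -o' → 0 ≤ d + -o + -o' := fun h1 h2 ↦
    WithTop.coe_le_coe.1 (hd₂ (WithTop.coe_le_coe.2 h1) (WithTop.coe_le_coe.2 h2))
  have k₃ : o ≠ o' → d = min o o' := fun h1 ↦ by
    have := hd₃ (by exact_mod_cast h1)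
    exact_mod_cast this
  simp only [WithTop.untop₀_coe, negPart_def, posPart_def]
  rcases lt_trichotomy o o' with h1 | h1 | h1
  · have := k₃ h1.ne
    omega
  · omega
  · have := k₃ h1.ne'
    omega

/-- At each point g has at most one limit a, so at most one summand is nonzero there. -/
lemma sum_inf_divisor_le {g : ℂ → ℂ} (hg : Meromorphic g) (A : Finset ℂ)
    {D : Function.locallyFinsupp ℂ ℤ} (hD : 0 ≤ D) :
    ∑ a ∈ A, (divisor (g · - a) Set.univ)⁺ ⊓ D ≤ D := by
  classical
  rw [Function.locallyFinsuppWithin.le_def]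
  intro z
  rw [Function.locallyFinsuppWithin.coe_sum, Finset.sum_apply]
  have hm : ∀ a, Meromorphic (g · - a) := fun a z ↦ (hg z).sub (MeromorphicAt.const a z)
  have hz : ∀ a, ¬ 0 < meromorphicOrderAt (g · - a) z →
      ((divisor (g · - a) Set.univ)⁺ ⊓ D) z = 0 := by
    intro a ha
    rw [Function.locallyFinsuppWithin.min_apply, Function.locallyFinsuppWithin.posPart_apply,
      divisor_apply (hm a).meromorphicOn (Set.mem_univ z), posPart_eq_zero.2]
    · exact min_eq_left (hD z)
    · have := WithTop.untop₀_le_untop₀ (α := ℤ) (by simp) (not_lt.1 ha)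
      simpa using this
  by_cases hex : ∃ a ∈ A, 0 < meromorphicOrderAt (g · - a) z
  · obtain ⟨a, ha, hpos⟩ := hex
    rw [Finset.sum_eq_single_of_mem a ha]
    · exact min_le_right _ _
    · intro b _ hba
      refine hz b fun hb ↦ hba ?_
      have t₁ := tendsto_zero_of_meromorphicOrderAt_pos hpos
      have t₂ := tendsto_zero_of_meromorphicOrderAt_pos hb
      have t₃ := tendsto_nhds_unique (t₁.sub t₂) (tendsto_const_nhds (x := b - a) |>.congr
        fun w ↦ by ring)
      rw [sub_zero] at t₃
      exact (sub_eq_zero.1 t₃.symm)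
  · push Not at hex
    rw [Finset.sum_eq_zero fun a ha ↦ hz a (hex a ha).not_gt]
    exact hD z

end HahnNevanlinna

/-! ### First main theorem and growth of the characteristic -/

namespace HahnNevanlinna

open Real Metric

variable {g : ℂ → ℂ}

lemma exists_characteristic_sub_inv_le (hg : Meromorphic g) (a : ℂ) :
    ∃ C, ∀ r, |characteristic g ⊤ r -
      (proximity (g · - a)⁻¹ ⊤ r + logCounting g a r)| ≤ C := by
  have hm : Meromorphic (g · - a) := fun z ↦ (hg z).sub (MeromorphicAt.const a z)
  obtain ⟨C, -, hC⟩ := characteristic_inv_le hm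
  refine ⟨C + (log⁺ ‖a‖ + log 2), fun r ↦ ?_⟩
  have h₁ := abs_characteristic_sub_characteristic_shift_le (a₀ := a) (r := r) hg
  have h₂ := hC r
  have h₃ : characteristic (g · - a)⁻¹ ⊤ r = proximity (g · - a)⁻¹ ⊤ r + logCounting g a r := by
    rw [characteristic, Pi.add_apply, logCounting_inv, logCounting_coe_eq_logCounting_sub_const_zero]
    rfl
  rw [h₃] at h₂
  rw [abs_le] at *
  constructor <;> linarith

lemma exists_logCounting_le_characteristic (hg : Meromorphic g) (a : WithTop ℂ) :
    ∃ C, ∀ r, logCounting g a r ≤ characteristic g ⊤ r + C := by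
  cases a with
  | top => exact ⟨0, fun r ↦ by simpa using logCounting_le_characteristic⟩
  | coe a =>
    obtain ⟨C, hC⟩ := exists_characteristic_sub_inv_le hg a
    refine ⟨C, fun r ↦ ?_⟩
    have h₁ := (abs_le.1 (hC r)).1
    have h₂ := proximity_nonneg (f := (g · - a)⁻¹) (a := ⊤) r
    simp only [Pi.zero_apply] at h₂
    linarith

lemma log_le_logCounting_of_pos {D : Function.locallyFinsupp ℂ ℤ} (hD : 0 ≤ D) (h : 0 < D 0) {r : ℝ}
    (hr : 1 ≤ r) : log r ≤ Function.locallyFinsuppWithin.logCounting D r := by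
  have h₁ := sum_mul_log_le_logCounting hD le_rfl hr (S := {0}) (by simp)
  rw [Finset.sum_singleton, mul_one] at h₁
  refine le_trans ?_ h₁
  exact le_mul_of_one_le_left (log_nonneg hr) (by exact_mod_cast h)

/-- Some value in ℂ ∪ {∞} is taken at the origin. Its counting function is at least log r, and the
first main theorem passes this on to T. -/
lemma NonConstant.tendsto_T_atTop (hg : Meromorphic g) (h : NonConstant g) :
    Tendsto (T g) atTop atTop := by
  have hex : ∃ a : WithTop ℂ, ∀ r, 1 ≤ r → log r ≤ logCounting g a r := by
    by_cases h0 : meromorphicOrderAt g 0 < 0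
    · refine ⟨⊤, fun r hr ↦ ?_⟩
      rw [logCounting_top]
      refine log_le_logCounting_of_pos (negPart_nonneg _) ?_ hr
      rw [Function.locallyFinsuppWithin.negPart_apply, divisor_apply hg.meromorphicOn
        (Set.mem_univ _), negPart_pos_iff]
      obtain ⟨n, hn⟩ := WithTop.ne_top_iff_exists.1 (h.meromorphicOrderAt_ne_top hg 0)
      rw [← hn] at h0 ⊢
      exact WithTop.coe_lt_coe.1 h0
    · obtain ⟨a, ha⟩ := exists_meromorphicOrderAt_sub_pos (hg 0) (not_lt.1 h0)
      have hm : Meromorphic (g · - a) := fun z ↦ (hg z).sub (MeromorphicAt.const a z)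
      refine ⟨a, fun r hr ↦ ?_⟩
      rw [logCounting_coe]
      refine log_le_logCounting_of_pos (posPart_nonneg _) ?_ hr
      rw [Function.locallyFinsuppWithin.posPart_apply, divisor_apply hm.meromorphicOn
        (Set.mem_univ _), posPart_pos_iff]
      obtain ⟨n, hn⟩ := WithTop.ne_top_iff_exists.1 (h.meromorphicOrderAt_sub_ne_top hg a 0)
      rw [← hn] at ha ⊢
      exact WithTop.coe_lt_coe.1 ha
  obtain ⟨a, ha⟩ := hex
  obtain ⟨C, hC⟩ := exists_logCounting_le_characteristic hg a
  refine tendsto_atTop_mono' atTop ?_ (tendsto_atTop_add_const_right _ (-C) tendsto_log_atTop)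
  filter_upwards [eventually_ge_atTop 1] with r hr
  have := ha r hr
  have := hC r
  simp only [T]
  linarith

/-- Otherwise T at least doubles with each factor K from some radius on, so T(Kⁿr₀) ≥ 2ⁿ, which
makes the order positive. -/
lemma frequently_T_mul_le (hT : Tendsto (T g) atTop atTop) (hord : growthOrder g = 0) {K : ℝ}
    (hK : 1 < K) : ∃ᶠ r in atTop, T g (K * r) ≤ 2 * T g r := by
  intro hev
  obtain ⟨r₁, hr₁⟩ := eventually_atTop.1 hev
  obtain ⟨r₀, h₀, h₀', h₀''⟩ := ((eventually_ge_atTop r₁).and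
    ((eventually_ge_atTop 2).and (hT.eventually_ge_atTop 1))).exists
  have hpow : ∀ n : ℕ, 1 ≤ K ^ n := fun n ↦ one_le_pow₀ hK.le
  have hind : ∀ n : ℕ, 2 ^ n ≤ T g (K ^ n * r₀) := by
    intro n
    induction n with
    | zero => simpa using h₀''
    | succ n ih =>
      have := hr₁ (K ^ n * r₀) (h₀.trans (le_mul_of_one_le_left (by linarith) (hpow n)))
      rw [not_le, ← mul_assoc, ← pow_succ'] at this
      rw [pow_succ]
      linarith
  have hlogK : 0 < log K := log_pos hK
  have hlogr : 0 < log r₀ := log_pos (by linarith)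
  -- For n ≥ 1, log(Kⁿr₀) ≤ n (log K + log r₀), so δ bounds the order quotient below along the
  -- sequence.
  set δ := log 2 / (log K + log r₀)
  have hδ : 0 < δ := div_pos (log_pos (by norm_num)) (by positivity)
  have htend : Tendsto (fun n : ℕ ↦ K ^ n * r₀) atTop atTop :=
    (tendsto_pow_atTop_atTop_of_one_lt hK).atTop_mul_const (by linarith)
  have hfreq : ∃ᶠ r in atTop, ((δ : ℝ) : EReal) ≤ ((log⁺ (T g r) / log r : ℝ) : EReal) := by
    refine htend.frequently (Eventually.frequently ?_)
    filter_upwards [eventually_ge_atTop 1] with n hn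
    rw [EReal.coe_le_coe_iff]
    have hn' : (1 : ℝ) ≤ n := by exact_mod_cast hn
    have h₁ : n * log 2 ≤ log⁺ (T g (K ^ n * r₀)) := by
      rw [← log_pow]
      exact (log_le_log (by positivity) (hind n)).trans (le_max_right _ _)
    have h₂ : log (K ^ n * r₀) = n * log K + log r₀ := by
      rw [log_mul (by positivity) (by positivity), log_pow]
    rw [h₂]
    simp only [δ]
    rw [div_le_div_iff₀ (by positivity) (by positivity)]
    have h2 : 0 ≤ log 2 := log_nonneg (by norm_num)
    calc log 2 * (n * log K + log r₀) ≤ log 2 * (n * log K + n * log r₀) := by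
          gcongr
          exact le_mul_of_one_le_left hlogr.le hn'
      _ = n * log 2 * (log K + log r₀) := by ring
      _ ≤ _ := by gcongr
  have := le_limsup_of_frequently_le hfreq
  rw [growthOrder] at hord
  rw [hord] at this
  exact absurd (EReal.coe_nonpos.1 this) (not_le.2 hδ)

end HahnNevanlinna

/-! ### Second main theorem -/

namespace HahnNevanlinna

open Real Metric

variable {g : ℂ → ℂ} {q c : ℂ}

/-- A point can be close to at most one of finitely many values. -/
lemma exists_sum_posLog_inv_le (A : Finset ℂ) : ∃ C, ∀ w d : ℂ, d ≠ 0 →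
    ∑ a ∈ A, log⁺ ‖(w - a)⁻¹‖ ≤ ∑ a ∈ A, log⁺ ‖d / (w - a)‖ + log⁺ ‖d⁻¹‖ + C := by
  classical
  -- With all values of A at least δ apart, a point within δ/2 of one of them is at least δ/2 from
  -- the others.
  have hev : ∀ᶠ δ : ℝ in 𝓝[>] 0, ∀ p ∈ A.offDiag, δ ≤ ‖p.1 - p.2‖ := by
    rw [Filter.eventually_all_finset]
    intro p hp
    have : 0 < ‖p.1 - p.2‖ := norm_pos_iff.2 (sub_ne_zero.2 (Finset.mem_offDiag.1 hp).2.2)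
    exact ((tendsto_id (x := 𝓝 (0 : ℝ))).eventually_le_const this).filter_mono
      nhdsWithin_le_nhds
  obtain ⟨δ, hδ, hδ0⟩ := (hev.and self_mem_nhdsWithin).exists
  have hδ0 : 0 < δ := hδ0
  set B := log⁺ (2 / δ)
  have hB : 0 ≤ B := posLog_nonneg
  have hfar : ∀ w a : ℂ, δ / 2 ≤ ‖w - a‖ → log⁺ ‖(w - a)⁻¹‖ ≤ B := fun w a h ↦ by
    apply posLog_le_posLog (norm_nonneg _)
    rw [norm_inv, ← inv_div]
    exact inv_anti₀ (by positivity) h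
  refine ⟨A.card * B, fun w d hd ↦ ?_⟩
  have hpos : 0 ≤ ∑ a ∈ A, log⁺ ‖d / (w - a)‖ := Finset.sum_nonneg fun _ _ ↦ posLog_nonneg
  have hpos' : 0 ≤ log⁺ ‖d⁻¹‖ := posLog_nonneg
  by_cases hall : ∀ a ∈ A, δ / 2 ≤ ‖w - a‖
  · have : ∑ a ∈ A, log⁺ ‖(w - a)⁻¹‖ ≤ ∑ a ∈ A, B :=
      Finset.sum_le_sum fun a ha ↦ hfar w a (hall a ha)
    rw [Finset.sum_const, nsmul_eq_mul] at this
    linarith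
  · push Not at hall
    obtain ⟨b, hb, hwb⟩ := hall
    rw [← Finset.add_sum_erase A _ hb]
    have h₁ : log⁺ ‖(w - b)⁻¹‖ ≤ ∑ a ∈ A, log⁺ ‖d / (w - a)‖ + log⁺ ‖d⁻¹‖ := by
      calc log⁺ ‖(w - b)⁻¹‖ = log⁺ (‖d / (w - b)‖ * ‖d⁻¹‖) := by
            rw [← norm_mul]; congr 2; field_simp
        _ ≤ log⁺ ‖d / (w - b)‖ + log⁺ ‖d⁻¹‖ := posLog_mul
        _ ≤ _ := by
            gcongr
            exact Finset.single_le_sum (f := fun a ↦ log⁺ ‖d / (w - a)‖)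
              (fun _ _ ↦ posLog_nonneg) hb
    have h₂ : ∑ a ∈ A.erase b, log⁺ ‖(w - a)⁻¹‖ ≤ ∑ a ∈ A, B := by
      refine (Finset.sum_le_sum fun a ha ↦ hfar w a ?_).trans
        (Finset.sum_le_sum_of_subset_of_nonneg (Finset.erase_subset _ _) fun _ _ _ ↦ hB)
      obtain ⟨hab, ha⟩ := Finset.mem_erase.1 ha
      have h₃ := hδ (a, b) (Finset.mem_offDiag.2 ⟨ha, hb, hab⟩)
      have h₄ := norm_sub_le (w - b) (w - a)
      rw [sub_sub_sub_cancel_left] at h₄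
      simp only at h₃
      linarith
    rw [Finset.sum_const, nsmul_eq_mul] at h₂
    linarith

lemma meromorphic_sub_const (hg : Meromorphic g) (a : ℂ) : Meromorphic fun z ↦ g z - a :=
  fun z ↦ (hg z).sub (MeromorphicAt.const a z)

lemma eventually_ne_zero_codiscreteWithin {f : ℂ → ℂ} (hf : Meromorphic f)
    (hf' : ∀ z, meromorphicOrderAt f z ≠ ⊤) (s : Set ℂ) : ∀ᶠ z in codiscreteWithin s, f z ≠ 0 :=
  hf.meromorphicOn.eventually_codiscreteWithin_apply_ne_zero fun z _ ↦ hf' z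

lemma NonConstant.exists_sum_proximity_le (hg : Meromorphic g) (h : NonConstant g)
    (hq0 : 0 < ‖q‖) (hq1 : ‖q‖ < 1) (A : Finset ℂ) : ∃ C, ∀ r, r ≠ 0 →
    ∑ a ∈ A, proximity (g · - a)⁻¹ ⊤ r ≤
      ∑ a ∈ A, circleAverage (fun z ↦ log⁺ ‖hahnDiff q c g z / (g z - a)‖) 0 r +
        proximity (hahnDiff q c g)⁻¹ ⊤ r + C := by
  obtain ⟨C, hC⟩ := exists_sum_posLog_inv_le A
  refine ⟨C, fun r hr ↦ ?_⟩
  have hD := meromorphic_hahnDiff hg q c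
  have i₁ : ∀ a ∈ A, CircleIntegrable (fun z ↦ log⁺ ‖(g z - a)⁻¹‖) 0 r := fun a _ ↦
    (meromorphic_sub_const hg a).inv.meromorphicOn.circleIntegrable_posLog_norm
  have i₂ : ∀ a ∈ A, CircleIntegrable (fun z ↦ log⁺ ‖hahnDiff q c g z / (g z - a)‖) 0 r :=
    fun a _ ↦ (hD.div (meromorphic_sub_const hg a)).meromorphicOn.circleIntegrable_posLog_norm
  have i₃ : CircleIntegrable (fun z ↦ log⁺ ‖(hahnDiff q c g z)⁻¹‖) 0 r :=
    hD.inv.meromorphicOn.circleIntegrable_posLog_norm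
  have i₄ := CircleIntegrable.fun_sum A i₂
  simp only [proximity_top, Pi.inv_apply]
  rw [← circleAverage_fun_sum i₁, ← circleAverage_fun_sum i₂, ← circleAverage_fun_add i₄ i₃]
  have i₅ : CircleIntegrable (fun _ ↦ C) 0 r := circleIntegrable_const C 0 r
  rw [← circleAverage_const C 0 r]
  rw [← circleAverage_fun_add (f₁ := fun z ↦ ∑ a ∈ A, log⁺ ‖hahnDiff q c g z / (g z - a)‖ +
    log⁺ ‖(hahnDiff q c g z)⁻¹‖) (i₄.add i₃) i₅]
  refine circleAverage_mono_codiscreteWithin hr (CircleIntegrable.fun_sum A i₁)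
    ((i₄.add i₃).add i₅) ?_
  filter_upwards [eventually_ne_zero_codiscreteWithin hD
    (h.meromorphicOrderAt_hahnDiff_ne_top hg hq0 hq1) _] with z hz
  exact hC (g z) (hahnDiff q c g z) hz

lemma NonConstant.proximity_hahnDiff_le (hg : Meromorphic g) (h : NonConstant g) {r : ℝ}
    (hr : r ≠ 0) : proximity (hahnDiff q c g) ⊤ r ≤
      proximity g ⊤ r + circleAverage (fun z ↦ log⁺ ‖hahnDiff q c g z / g z‖) 0 r := by
  have hD := meromorphic_hahnDiff hg q c
  have i₁ : CircleIntegrable (fun z ↦ log⁺ ‖g z‖) 0 r :=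
    hg.meromorphicOn.circleIntegrable_posLog_norm
  have i₂ : CircleIntegrable (fun z ↦ log⁺ ‖hahnDiff q c g z / g z‖) 0 r :=
    (hD.div hg).meromorphicOn.circleIntegrable_posLog_norm
  simp only [proximity_top]
  rw [← circleAverage_fun_add i₁ i₂]
  refine circleAverage_mono_codiscreteWithin hr hD.meromorphicOn.circleIntegrable_posLog_norm
    (i₁.add i₂) ?_
  filter_upwards [eventually_ne_zero_codiscreteWithin hg (h.meromorphicOrderAt_ne_top hg) _]
    with z hz
  have : ‖hahnDiff q c g z‖ = ‖g z‖ * ‖hahnDiff q c g z / g z‖ := by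
    rw [← norm_mul]; congr 1; field_simp
  rw [this]
  exact posLog_mul

/-- Here Dg/(g-a) is (g(qz + c) - a)/(g-a) - 1 divided by (q-1)z + c, and that divisor has modulus
at least 1 on large circles. -/
lemma circleAverage_posLog_hahnDiff_div_le (hg : Meromorphic g) (hq1 : ‖q‖ < 1) (a : ℂ) :
    ∀ᶠ r in atTop, circleAverage (fun z ↦ log⁺ ‖hahnDiff q c g z / (g z - a)‖) 0 r ≤
      circleAverage (fun z ↦ log⁺ ‖(g (q * z + c) - a) / (g z - a)‖) 0 r + log 2 := by
  have hq : 0 < ‖q - 1‖ := norm_pos_iff.2 (sub_ne_zero.2 (by rintro rfl; simp at hq1))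
  have hm := meromorphic_sub_const hg a
  filter_upwards [eventually_ge_atTop ((1 + ‖c‖) / ‖q - 1‖), eventually_gt_atTop 0] with r hr hr0
  have i₁ : CircleIntegrable (fun z ↦ log⁺ ‖(g (q * z + c) - a) / (g z - a)‖) 0 r :=
    ((meromorphic_comp_affine hm q c).div hm).meromorphicOn.circleIntegrable_posLog_norm
  have i₂ := circleIntegrable_const (log 2) 0 r
  rw [← circleAverage_const (log 2) 0 r, ← circleAverage_fun_add i₁ i₂]
  refine circleAverage_mono
    ((meromorphic_hahnDiff hg q c).div hm).meromorphicOn.circleIntegrable_posLog_norm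
    (i₁.add i₂) fun z hz ↦ ?_
  by_cases hz0 : g z - a = 0
  · simp only [hz0, div_zero, norm_zero, posLog_zero, zero_add]
    exact log_nonneg (by norm_num)
  have hzr : ‖z‖ = r := by simpa [abs_of_pos hr0] using hz
  have hl : 1 ≤ ‖(q - 1) * z + c‖ := by
    rw [div_le_iff₀' hq] at hr
    have := norm_sub_le ((q - 1) * z + c) c
    rw [add_sub_cancel_right, norm_mul, hzr] at this
    linarith
  calc log⁺ ‖hahnDiff q c g z / (g z - a)‖
      ≤ log⁺ ‖(g (q * z + c) - a) / (g z - a) + (-1)‖ := by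
        apply posLog_le_posLog (norm_nonneg _)
        have : hahnDiff q c g z / (g z - a) =
            ((g (q * z + c) - a) / (g z - a) + (-1)) / ((q - 1) * z + c) := by
          rw [hahnDiff]
          field_simp
          ring
        rw [this, norm_div]
        exact div_le_self (norm_nonneg _) hl
    _ ≤ log⁺ ‖(g (q * z + c) - a) / (g z - a)‖ + log⁺ ‖(-1 : ℂ)‖ + log 2 := posLog_norm_add_le _ _
    _ = _ := by simp

lemma hahnDivisor_top (q c : ℂ) (g : ℂ → ℂ) : hahnDivisor q c g ⊤ = (divisor g Set.univ)⁻ -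
    (divisor g Set.univ)⁻ ⊓ (divisor (hahnDiff q c g⁻¹) Set.univ)⁺ := rfl

lemma hahnDivisor_coe (q c : ℂ) (g : ℂ → ℂ) (a : ℂ) :
    hahnDivisor q c g a = (divisor (g · - a) Set.univ)⁺ -
      (divisor (g · - a) Set.univ)⁺ ⊓ (divisor (hahnDiff q c g) Set.univ)⁺ := rfl

/-- The second main theorem for the Hahn difference operator, up to proximity functions of
quotients. -/
theorem NonConstant.exists_second_main_le (hg : Meromorphic g) (h : NonConstant g)
    (hq0 : 0 < ‖q‖) (hq1 : ‖q‖ < 1) (A : Finset ℂ) : ∃ C, ∀ᶠ r in atTop,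
    (A.card - 1) * T g r ≤ ∑ a ∈ A, hahnCounting q c g a r + hahnCounting q c g ⊤ r +
      (∑ a ∈ A, circleAverage (fun z ↦ log⁺ ‖(g (q * z + c) - a) / (g z - a)‖) 0 r +
        circleAverage (fun z ↦ log⁺ ‖(g (q * z + c) - 0) / (g z - 0)‖) 0 r) + C := by
  have hD := meromorphic_hahnDiff hg q c
  obtain ⟨C₁, hC₁⟩ := h.exists_sum_proximity_le hg hq0 hq1 (c := c) A
  obtain ⟨C₂, -, hC₂⟩ := characteristic_inv_le hD
  obtain ⟨C₃, hC₃⟩ := exists_logCounting_comp_affine_le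
    (D := (divisor g Set.univ)⁻) (D' := (divisor (fun z ↦ g (q * z + c)) Set.univ)⁻)
    (negPart_nonneg _) hq0 hq1 (c := c) (fun z ↦ by
      rw [Function.locallyFinsuppWithin.negPart_apply, Function.locallyFinsuppWithin.negPart_apply,
        divisor_apply (meromorphic_comp_affine hg q c).meromorphicOn (Set.mem_univ z),
        divisor_apply hg.meromorphicOn (Set.mem_univ _),
        meromorphicOrderAt_comp_affine (norm_pos_iff.1 hq0)])
  choose C₄ hC₄ using exists_characteristic_sub_inv_le hg
  refine ⟨C₁ + C₂ + C₃ + ∑ a ∈ A, C₄ a + A.card * log 2 + log 2, ?_⟩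
  have hall : ∀ᶠ r in atTop, ∀ a ∈ A,
      circleAverage (fun z ↦ log⁺ ‖hahnDiff q c g z / (g z - a)‖) 0 r ≤
      circleAverage (fun z ↦ log⁺ ‖(g (q * z + c) - a) / (g z - a)‖) 0 r + log 2 :=
    (Filter.eventually_all_finset A).2 fun a _ ↦ circleAverage_posLog_hahnDiff_div_le hg hq1 a
  filter_upwards [hC₃, hall, circleAverage_posLog_hahnDiff_div_le (c := c) hg hq1 0,
    eventually_ge_atTop 1] with r h₃ h₄ h₅ hr
  have hr0 : r ≠ 0 := by linarith
  have e₁ := hC₁ r hr0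
  have e₂ := (abs_le.1 (hC₂ r)).1
  have e₃ : (A.card : ℝ) * T g r - ∑ a ∈ A, C₄ a ≤
      ∑ a ∈ A, proximity (g · - a)⁻¹ ⊤ r + ∑ a ∈ A, logCounting g a r := by
    rw [← Finset.sum_add_distrib, sub_le_iff_le_add, ← Finset.sum_add_distrib, ← nsmul_eq_mul,
      ← Finset.sum_const]
    refine Finset.sum_le_sum fun a _ ↦ ?_
    have := (abs_le.1 (hC₄ a r)).2
    simp only [T]
    linarith
  have e₄ := Finset.sum_le_sum h₄
  rw [Finset.sum_add_distrib, Finset.sum_const, nsmul_eq_mul] at e₄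
  have e₅ := h.proximity_hahnDiff_le (q := q) (c := c) hg hr0
  simp only [sub_zero] at h₅ ⊢
  have e₆ : T g r = proximity g ⊤ r + logCounting g ⊤ r := rfl
  have e₇ : characteristic (hahnDiff q c g) ⊤ r =
      proximity (hahnDiff q c g) ⊤ r + logCounting (hahnDiff q c g) ⊤ r := rfl
  have e₈ : characteristic (hahnDiff q c g)⁻¹ ⊤ r =
      proximity (hahnDiff q c g)⁻¹ ⊤ r + logCounting (hahnDiff q c g) 0 r := by
    rw [characteristic, Pi.add_apply, logCounting_inv]
  have e₉ := Function.locallyFinsuppWithin.logCounting_le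
    (h.negPart_divisor_hahnDiff_add_le hg hq0 hq1 (c := c)) hr
  rw [map_add, map_add, ← logCounting_top, ← logCounting_top, ← logCounting_top, Pi.add_apply,
    Pi.add_apply] at e₉
  rw [← logCounting_top, ← logCounting_top] at h₃
  have e₁₀ : hahnCounting q c g ⊤ r = logCounting g ⊤ r -
      Function.locallyFinsuppWithin.logCounting ((divisor g Set.univ)⁻ ⊓
        (divisor (hahnDiff q c g⁻¹) Set.univ)⁺) r := by
    rw [hahnCounting, hahnDivisor_top, map_sub, ← logCounting_top, Pi.sub_apply]
  have e₁₁ := Function.locallyFinsuppWithin.logCounting_le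
    (sum_inf_divisor_le hg A (posPart_nonneg (divisor (hahnDiff q c g) Set.univ))) hr
  rw [map_sum, Finset.sum_apply, ← logCounting_zero] at e₁₁
  have e₁₂ : ∑ a ∈ A, hahnCounting q c g a r = ∑ a ∈ A, logCounting g a r -
      ∑ a ∈ A, Function.locallyFinsuppWithin.logCounting ((divisor (g · - a) Set.univ)⁺ ⊓
        (divisor (hahnDiff q c g) Set.univ)⁺) r := by
    rw [← Finset.sum_sub_distrib]
    refine Finset.sum_congr rfl fun a _ ↦ ?_
    rw [hahnCounting, hahnDivisor_coe, map_sub, ← logCounting_coe, Pi.sub_apply]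
  -- At ∞, m(r, g) + N(r, Dg) is at most T(r, g) plus the Hahn counting function, up to a constant.
  -- At finite values, -N(r, 1/Dg) absorbs the parts removed from the counting functions.
  linarith

theorem NonConstant.frequently_second_main_le (hg : Meromorphic g) (h : NonConstant g)
    (hord : growthOrder g = 0) (hq0 : 0 < ‖q‖) (hq1 : ‖q‖ < 1) (A : Finset ℂ) {η : ℝ}
    (hη : 0 < η) : ∃ᶠ r in atTop,
    (A.card - 1) * T g r ≤
      ∑ a ∈ A, hahnCounting q c g a r + hahnCounting q c g ⊤ r + η * T g r := by
  obtain ⟨C, hC⟩ := h.exists_second_main_le (c := c) hg hq0 hq1 A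
  -- There are |A| + 1 quotient terms, each at most ε T(k²r) ≤ 2ε T(r) up to a constant, for a total
  -- of (η/2) T(r). The other half of η absorbs the constants, since T → ∞.
  set ε := η / (4 * (A.card + 1))
  have hε : 0 < ε := by positivity
  have hquot : ∀ a : ℂ, ∀ᶠ k : ℝ in atTop, ∃ C, ∀ᶠ r in atTop,
      circleAverage (fun z ↦ log⁺ ‖(g (q * z + c) - a) / (g z - a)‖) 0 r ≤
        ε * T g (k * (k * r)) + C := by
    intro a
    filter_upwards [exists_circleAverage_posLog_comp_div_le (c := c) (meromorphic_sub_const hg a)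
      (h.meromorphicOrderAt_sub_ne_top hg a) hq0 hq1 hε] with k ⟨C', hC'⟩
    refine ⟨ε * (log⁺ ‖a‖ + log 2) + C', ?_⟩
    filter_upwards [hC'] with r hr
    have := (abs_le.1
      (abs_characteristic_sub_characteristic_shift_le (a₀ := a) (r := k * (k * r)) hg)).1
    calc _ ≤ ε * characteristic (g · - a) ⊤ (k * (k * r)) + C' := hr
      _ ≤ ε * (T g (k * (k * r)) + (log⁺ ‖a‖ + log 2)) + C' := by
        gcongr
        simp only [T]
        linarith
      _ = _ := by ring
  obtain ⟨k, hk₁, hk₂, hk₃⟩ := (((Filter.eventually_all_finset A).2 fun a _ ↦ hquot a).and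
    ((hquot 0).and (eventually_gt_atTop 1))).exists
  choose! C' hC' using hk₁
  obtain ⟨C₀, hC₀⟩ := hk₂
  have hT := h.tendsto_T_atTop hg
  have hfreq := frequently_T_mul_le hT hord (K := k * k) (by nlinarith)
  refine (hfreq.and_eventually (hC.and (((Filter.eventually_all_finset A).2 hC').and
    (hC₀.and (hT.eventually_ge_atTop ((∑ a ∈ A, C' a + C₀ + C) * (2 / η))))))).mono ?_
  rintro r ⟨h₁, h₂, h₃, h₄, h₅⟩
  rw [mul_assoc] at h₁
  have h₃' := Finset.sum_le_sum h₃
  rw [Finset.sum_add_distrib, Finset.sum_const, nsmul_eq_mul] at h₃'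
  have h₆ : ∑ a ∈ A, C' a + C₀ + C ≤ η / 2 * T g r := by
    have : 0 < η / 2 := by positivity
    calc ∑ a ∈ A, C' a + C₀ + C = η / 2 * ((∑ a ∈ A, C' a + C₀ + C) * (2 / η)) := by field_simp
      _ ≤ _ := by gcongr
  have h₇ : (A.card + 1) * (ε * T g (k * (k * r))) ≤ η / 2 * T g r := by
    calc (A.card + 1) * (ε * T g (k * (k * r))) ≤ (A.card + 1) * (ε * (2 * T g r)) := by gcongr
      _ = η / 2 * T g r := by simp only [ε]; field_simp; ring
  linarith

end HahnNevanlinna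

/-! ### Defects, indices and the defect relation -/

namespace HahnNevanlinna

variable {g : ℂ → ℂ} {q c : ℂ}

lemma hahnCounting_nonneg (q c : ℂ) (g : ℂ → ℂ) (a : WithTop ℂ) {r : ℝ} (hr : 1 ≤ r) :
    0 ≤ hahnCounting q c g a r := by
  refine Function.locallyFinsuppWithin.logCounting_nonneg ?_ hr
  cases a with
  | top => rw [hahnDivisor_top]; exact sub_nonneg.2 inf_le_left
  | coe a => rw [hahnDivisor_coe]; exact sub_nonneg.2 inf_le_left

lemma hahnCounting_le_logCounting (q c : ℂ) (g : ℂ → ℂ) (a : WithTop ℂ) {r : ℝ} (hr : 1 ≤ r) :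
    hahnCounting q c g a r ≤ logCounting g a r := by
  cases a with
  | top =>
    rw [logCounting_top, hahnCounting, hahnDivisor_top]
    exact Function.locallyFinsuppWithin.logCounting_le
      (sub_le_self _ (le_inf (negPart_nonneg _) (posPart_nonneg _))) hr
  | coe a =>
    rw [logCounting_coe, hahnCounting, hahnDivisor_coe]
    exact Function.locallyFinsuppWithin.logCounting_le
      (sub_le_self _ (le_inf (posPart_nonneg _) (posPart_nonneg _))) hr

lemma eventually_logCounting_div_le (hg : Meromorphic g) (hT : Tendsto (T g) atTop atTop)
    (a : WithTop ℂ) {b : ℝ} (hb : 1 < b) : ∀ᶠ r in atTop, logCounting g a r / T g r ≤ b := by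
  obtain ⟨C, hC⟩ := exists_logCounting_le_characteristic hg a
  filter_upwards [hT.eventually_gt_atTop 0, hT.eventually_ge_atTop (C / (b - 1))] with r h₀ h₁
  rw [div_le_iff₀ (by linarith)] at h₁
  rw [div_le_iff₀ h₀]
  have := hC r
  simp only [T] at *
  linarith

lemma limsup_le_one_of_eventually_le {u : ℝ → ℝ}
    (h₀ : ∀ᶠ r in atTop, 0 ≤ u r) (h : ∀ b, 1 < b → ∀ᶠ r in atTop, u r ≤ b) :
    limsup u atTop ≤ 1 := by
  refine le_of_forall_gt_imp_ge_of_dense fun b hb ↦ ?_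
  exact limsup_le_of_le (isCoboundedUnder_le_of_eventually_le atTop h₀) (h b hb)

/-- Write N/T = u + y with u the Hahn part. Then limsup u + liminf y ≤ limsup (u + y) ≤ 1, the last
step by the first main theorem and T → ∞. Both parts are eventually nonnegative and bounded, as the
real limsup and liminf require. -/
lemma defect_and_indices (hg : Meromorphic g) (hT : Tendsto (T g) atTop atTop) (a : WithTop ℂ) :
    0 ≤ defect g a + hahnMultiplicityIndex q c g a ∧ 0 ≤ hahnRamificationIndex q c g a ∧
      defect g a + hahnMultiplicityIndex q c g a ≤ hahnRamificationIndex q c g a ∧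
      ∀ ε, 0 < ε → ∀ᶠ r in atTop,
        hahnCounting q c g a r ≤ (1 - hahnRamificationIndex q c g a + ε) * T g r := by
  have hle := fun b hb ↦ eventually_logCounting_div_le hg hT a (b := b) hb
  set x : ℝ → ℝ := fun r ↦ logCounting g a r / T g r
  set u : ℝ → ℝ := fun r ↦ hahnCounting q c g a r / T g r
  set y : ℝ → ℝ := fun r ↦ (logCounting g a r - hahnCounting q c g a r) / T g r
  have hTpos := hT.eventually_gt_atTop 0
  have hu₀ : ∀ᶠ r in atTop, 0 ≤ u r := by
    filter_upwards [hTpos, eventually_ge_atTop 1] with r h₁ h₂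
    exact div_nonneg (hahnCounting_nonneg q c g a h₂) h₁.le
  have hy₀ : ∀ᶠ r in atTop, 0 ≤ y r := by
    filter_upwards [hTpos, eventually_ge_atTop 1] with r h₁ h₂
    exact div_nonneg (sub_nonneg.2 (hahnCounting_le_logCounting q c g a h₂)) h₁.le
  have hadd : u + y = x := by
    ext r
    simp only [u, y, x, Pi.add_apply]
    ring
  have hx : ∀ r, x r = u r + y r := fun r ↦ by rw [← hadd]; rfl
  have hx₀ : ∀ᶠ r in atTop, 0 ≤ x r := by
    filter_upwards [hu₀, hy₀] with r h₁ h₂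
    rw [hx]
    exact add_nonneg h₁ h₂
  have hu : ∀ b, 1 < b → ∀ᶠ r in atTop, u r ≤ b := fun b hb ↦ by
    filter_upwards [hle b hb, hy₀] with r h₁ h₂
    have := hx r
    linarith
  have hy : ∀ᶠ r in atTop, y r ≤ 2 := by
    filter_upwards [hle 2 one_lt_two, hu₀] with r h₁ h₂
    have := hx r
    linarith
  have hub : IsBoundedUnder (· ≤ ·) atTop u := ⟨2, hu 2 one_lt_two⟩
  have hyb : IsBoundedUnder (· ≤ ·) atTop y := ⟨2, hy⟩
  have hdef : defect g a = 1 - limsup x atTop := rfl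
  have hmul : hahnMultiplicityIndex q c g a = liminf y atTop := rfl
  have hram : hahnRamificationIndex q c g a = 1 - limsup u atTop := rfl
  rw [hdef, hmul, hram]
  have h₁ := limsup_le_one_of_eventually_le hx₀ hle
  have h₂ := limsup_le_one_of_eventually_le hu₀ hu
  have h₃ : 0 ≤ liminf y atTop := le_liminf_of_le hyb.isCoboundedUnder_ge hy₀
  have h₄ : limsup u atTop + liminf y atTop ≤ limsup x atTop := by
    rw [← hadd]
    exact le_limsup_add hub (isCoboundedUnder_le_of_eventually_le atTop hu₀) hyb ⟨0, hy₀⟩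
  refine ⟨by linarith, by linarith, by linarith, fun ε hε ↦ ?_⟩
  filter_upwards [eventually_lt_of_limsup_lt (lt_add_of_pos_right _ hε) hub, hTpos] with r h₅ h₆
  rw [sub_sub_cancel, ← div_le_iff₀ h₆]
  exact h₅.le

lemma sum_hahnRamificationIndex_le (hg : Meromorphic g) (h : NonConstant g)
    (hord : growthOrder g = 0) (hq0 : 0 < ‖q‖) (hq1 : ‖q‖ < 1) (s : Finset (WithTop ℂ)) :
    ∑ a ∈ s, hahnRamificationIndex q c g a ≤ 2 := by
  classical
  have hT := h.tendsto_T_atTop hg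
  have hind := fun a ↦ defect_and_indices (q := q) (c := c) hg hT a
  set Θ := hahnRamificationIndex q c g
  set A : Finset ℂ := s.preimage (↑) WithTop.coe_injective.injOn
  have hsub : s ⊆ insert ⊤ (A.image (↑)) := by
    intro a ha
    cases a with
    | top => exact Finset.mem_insert_self _ _
    | coe a =>
      exact Finset.mem_insert_of_mem (Finset.mem_image_of_mem _ (Finset.mem_preimage.2 ha))
  refine (Finset.sum_le_sum_of_subset_of_nonneg hsub fun a _ _ ↦ (hind a).2.1).trans ?_
  rw [Finset.sum_insert (by simp), Finset.sum_image WithTop.coe_injective.injOn]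
  refine le_of_forall_pos_le_add fun ε hε ↦ ?_
  -- One η for each of the |A| + 1 counting functions, including that of ∞, and one for the error
  -- term.
  set η := ε / (A.card + 2)
  have hη : 0 < η := by positivity
  obtain ⟨r, h₁, h₂, h₃, h₄⟩ := ((h.frequently_second_main_le (c := c) hg hord hq0 hq1 A
    hη).and_eventually (((Filter.eventually_all_finset A).2 fun a _ ↦ (hind a).2.2.2 η hη).and
      (((hind ⊤).2.2.2 η hη).and (hT.eventually_gt_atTop 0)))).exists
  have h₂' := Finset.sum_le_sum h₂
  rw [← Finset.sum_mul, Finset.sum_add_distrib, Finset.sum_sub_distrib, Finset.sum_const,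
    Finset.sum_const, nsmul_eq_mul, nsmul_eq_mul] at h₂'
  have h₅ : (A.card - 1) * T g r ≤
      (A.card * 1 - ∑ a ∈ A, Θ a + A.card * η + (1 - Θ ⊤ + η) + η) * T g r := by linarith
  have h₆ := le_of_mul_le_mul_right h₅ h₄
  have h₇ : (A.card + 2) * η = ε := by simp only [η]; field_simp
  linarith

end HahnNevanlinna

theorem mainTheorem5 (g : ℂ → ℂ) (hg : Meromorphic g) (hconst : HahnNevanlinna.NonConstant g)
    (hord : HahnNevanlinna.growthOrder g = 0) (q c : ℂ) (hq0 : 0 < ‖q‖) (hq1 : ‖q‖ < 1) :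
    (Summable fun a : WithTop ℂ ↦
      HahnNevanlinna.defect g a + HahnNevanlinna.hahnMultiplicityIndex q c g a) ∧
    (Summable fun a : WithTop ℂ ↦ HahnNevanlinna.hahnRamificationIndex q c g a) ∧
    ∑' a : WithTop ℂ,
        (HahnNevanlinna.defect g a + HahnNevanlinna.hahnMultiplicityIndex q c g a) ≤
      ∑' a : WithTop ℂ, HahnNevanlinna.hahnRamificationIndex q c g a ∧
    ∑' a : WithTop ℂ, HahnNevanlinna.hahnRamificationIndex q c g a ≤ 2 := by
  have hind := fun a ↦ HahnNevanlinna.defect_and_indices (q := q) (c := c) hg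
    (hconst.tendsto_T_atTop hg) a
  have hsum := HahnNevanlinna.sum_hahnRamificationIndex_le (c := c) hg hconst hord hq0 hq1
  have hΘ : Summable fun a : WithTop ℂ ↦ HahnNevanlinna.hahnRamificationIndex q c g a :=
    summable_of_sum_le (fun a ↦ (hind a).2.1) hsum
  have hδ : Summable fun a : WithTop ℂ ↦
      HahnNevanlinna.defect g a + HahnNevanlinna.hahnMultiplicityIndex q c g a :=
    hΘ.of_nonneg_of_le (fun a ↦ (hind a).1) fun a ↦ (hind a).2.2.1
  exact ⟨hδ, hΘ, hδ.tsum_le_tsum (fun a ↦ (hind a).2.2.1) hΘ,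
    Real.tsum_le_of_sum_le (fun a ↦ (hind a).2.1) hsum⟩
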